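/- An XOR game $G=(\pi,f)$ on finite input sets $\mathbf X,\mathbf Y$ is a probability distribution $\pi$ on $\mathbf X\times\mathbf Y$ together with a function $f:\mathbf X\times\mathbf Y\to\{-1,1\}$; its coefficients are $T_{x,y}=\pi(x,y)f(x,y)$. For a set $S$ of families $P=(P(a,b|x,y))$, $a,b\in\{-1,1\}$, consider $\sup_{P\in S}\big|\sum_{a,b,x,y}\pi(x,y)\,ab\,f(x,y)P(a,b|x,y)\big|$. This supremum is denoted - $\omega(G)$ when $S$ consists of the classical distributions $P(a,b|x,y)=\int p_\lambda(a|x)q_\lambda(b|y)\,d\mu(\lambda)$, with $\mu$ a probability measure and $p_\lambda(\cdot|x)$, $q_\lambda(\cdot|y)$ probability distributions; - $\omega^*(G)$ when $S$ consists of the quantum distributions $P(a,b|x,y)=\mathrm{tr}\big((E_x^a\otimes F_y^b)\rho\big)$, with $\rho$ a density operator on a tensor product $H_1\otimes H_2$ of complex Hilbert spaces and $(E_x^a)_a$, $(F_y^b)_b$ POVMs on $H_1$, $H_2$; - $\omega_{o.w.-\log k}(G)$ ($k\ge 1$ an integer) when Alice and Bob share randomness $\lambda$, Alice outputs $a(x,\lambda)$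 and sends to Bob a message $m(x,\lambda)\in\{1,\dots,k\}$, and Bob outputs $b(y,\lambda,m)$; - $\omega^*_{o.w.-\log n}(G)$ ($n\ge1$ an integer) when Alice and Bob share randomness $\lambda$ (and no entanglement), Alice outputs $a(x,\lambda)$ and sends an $n$-dimensional quantum state $\rho(x,\lambda)$, and Bob outputs the result of a $\pm1$-valued POVM, depending on $(y,\lambda)$, on that state. Let $K_G^{\mathbb R}$ be the real Grothendieck constant, i.e. the least $K$ such that $\big|\sum_{i,j}T_{ij}\langle u_i,v_j\rangle\big|\le K$ for every real matrix $T$ with $\big|\sum_{i,j}T_{ij}t_is_j\big|\le1$ for all signs $t_i,s_j$, and all vectors $u_i,v_j$ in the unit ball of a real Hilbert space. **Theorem.** (1) For $n\ge1$ let $G_n$ be the XOR game in which Alice's inputs are the pairs $(x,z)\in\{-1,1\}^n\times\{-1,1\}^n$ ($2^{2n}$ inputs), Bob's inputs are $y\in\{-1,1\}^{n^2}$ ($2^{n^2}$ inputs), and the coefficients are $$T_{(x,z),y}=\frac1M\sum_{i,j=1}^n x_iz_jy_{ij},\qquad M=\sum_{x,z,y}\Big|\sum_{i,j=1}^n x_iz_jy_{ij}\Big|.$$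 There is a universal constant $C>0$ such that for every $n\ge1$ $$\omega^*_{o.w.-\log n}(G_n)\ \ge\ \frac{C}{\sqrt n},$$ and for every integer $k\ge e^2$ $$\omega_{o.w.-\log k}(G_n)\ \le\ \frac{2\sqrt2\,e^2}{n}\ln k,\qquad \frac{\omega^*_{o.w.-\log n}(G_n)}{\omega_{o.w.-\log k}(G_n)}\ \ge\ C\,\frac{\sqrt n}{\ln k}.$$ (2) Conversely, for every XOR game $G$ with finite input sets and all integers $n,k\ge1$, the values $\omega(G)$ and $\omega_{o.w.-\log k}(G)$ are positive, $$\omega^*_{o.w.-\log n}(G)\ \le\ \sqrt n\,\omega^*(G)\ \le\ K_G^{\mathbb R}\sqrt n\,\omega(G),$$ and $$\frac{\omega^*_{o.w.-\log n}(G)}{\omega_{o.w.-\log k}(G)}\ \le\ \frac{\omega^*_{o.w.-\log n}(G)}{\omega(G)}\ \le\ K_G^{\mathbb R}\sqrt n .$$ -/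

import Mathlib

open scoped TensorProduct ComplexOrder

universe u v

noncomputable section

/-! ### Bell functionals and bipartite distributions with outputs in `{-1, 1}` -/

/-- The real value of a sign. -/
def signVal (s : ℤˣ) : ℝ := ((s : ℤ) : ℝ)

/-- A Bell functional `B a b x y` (outputs `a b`, inputs `x y`). -/
abbrev BellFunctional (X : Type u) (Y : Type v) := ℤˣ → ℤˣ → X → Y → ℝ

/-- A family `P a b x y`, read as the conditional probability `P(a, b | x, y)`. -/
abbrev Behaviour (X : Type u) (Y : Type v) := ℤˣ → ℤˣ → X → Y → ℝ

section Values

variable {X : Type u} {Y : Type v}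

/-- The pairing of a Bell functional with a bipartite distribution. -/
def bellPairing [Fintype X] [Fintype Y] (B : BellFunctional X Y) (P : Behaviour X Y) : ℝ :=
  ∑ a : ℤˣ, ∑ b : ℤˣ, ∑ x : X, ∑ y : Y, B a b x y * P a b x y

/-- The supremum of `|⟨B, P⟩|` over a set of distributions. -/
def bellValue [Fintype X] [Fintype Y] (B : BellFunctional X Y) (S : Set (Behaviour X Y)) : ℝ :=
  sSup {r : ℝ | ∃ P ∈ S, r = |bellPairing B P|}

/-! ### No communication: classical and quantum distributions -/

/-- Classical distributions `P(a,b|x,y) = ∫ p_ω(a|x) q_ω(b|y) dμ(ω)`. -/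
def IsClassical (P : Behaviour X Y) : Prop :=
  ∃ (Ω : Type) (_ : MeasurableSpace Ω) (μ : MeasureTheory.Measure Ω)
    (p : Ω → X → ℤˣ → ℝ) (q : Ω → Y → ℤˣ → ℝ),
    MeasureTheory.IsProbabilityMeasure μ ∧
    (∀ x a, Measurable fun ω => p ω x a) ∧ (∀ y b, Measurable fun ω => q ω y b) ∧
    (∀ ω x a, 0 ≤ p ω x a) ∧ (∀ ω x, ∑ a, p ω x a = 1) ∧
    (∀ ω y b, 0 ≤ q ω y b) ∧ (∀ ω y, ∑ b, q ω y b = 1) ∧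
    ∀ a b x y, P a b x y = ∫ ω, p ω x a * q ω y b ∂μ

end Values

section Hilbert

/-- The trace `∑ᵢ ⟨eᵢ, T eᵢ⟩` in a Hilbert basis (for trace-class `T`, in particular for
`T = A ρ` with `ρ` a density operator, it does not depend on the basis). -/
def opTrace {K : Type*} [NormedAddCommGroup K] [InnerProductSpace ℂ K] [CompleteSpace K]
    (T : K →L[ℂ] K) : ℂ :=
  ∑' i, inner ℂ ((exists_hilbertBasis ℂ K).choose_spec.choose i)
    (T ((exists_hilbertBasis ℂ K).choose_spec.choose i))

/-- A density operator: positive, of trace one. -/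
def IsDensityOperator {K : Type*} [NormedAddCommGroup K] [InnerProductSpace ℂ K] [CompleteSpace K]
    (ρ : K →L[ℂ] K) : Prop :=
  ρ.IsPositive ∧ opTrace ρ = 1

/-- The two operators `E 1`, `E (-1)` form a POVM. -/
def IsPOVM {H : Type*} [NormedAddCommGroup H] [InnerProductSpace ℂ H] [CompleteSpace H]
    (E : ℤˣ → (H →L[ℂ] H)) : Prop :=
  (∀ a, (E a).IsPositive) ∧ ∑ a, E a = 1

/-- The Hilbert space tensor product: completion of the algebraic tensor product. -/
abbrev HilbertTensor (H₁ H₂ : Type) [NormedAddCommGroup H₁] [InnerProductSpace ℂ H₁]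
    [NormedAddCommGroup H₂] [InnerProductSpace ℂ H₂] : Type :=
  UniformSpace.Completion (H₁ ⊗[ℂ] H₂)

/-- The operator `A ⊗ B` on the Hilbert space tensor product: the continuous extension of the
algebraic tensor product of the operators. -/
def tensorOp {H₁ H₂ : Type} [NormedAddCommGroup H₁] [InnerProductSpace ℂ H₁]
    [NormedAddCommGroup H₂] [InnerProductSpace ℂ H₂] (A : H₁ →L[ℂ] H₁) (B : H₂ →L[ℂ] H₂) :
    HilbertTensor H₁ H₂ →L[ℂ] HilbertTensor H₁ H₂ :=
  ((UniformSpace.Completion.toComplL (𝕜 := ℂ) (E := H₁ ⊗[ℂ] H₂)).comp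
    (TensorProduct.mapL A B)).extend UniformSpace.Completion.toComplL

theorem tensorOp_tmul {H₁ H₂ : Type} [NormedAddCommGroup H₁] [InnerProductSpace ℂ H₁]
    [NormedAddCommGroup H₂] [InnerProductSpace ℂ H₂] (A : H₁ →L[ℂ] H₁) (B : H₂ →L[ℂ] H₂)
    (h₁ : H₁) (h₂ : H₂) :
    tensorOp A B ((h₁ ⊗ₜ[ℂ] h₂ : H₁ ⊗[ℂ] H₂) : HilbertTensor H₁ H₂) =
      ((A h₁ ⊗ₜ[ℂ] B h₂ : H₁ ⊗[ℂ] H₂) : HilbertTensor H₁ H₂) := by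
  have h := ContinuousLinearMap.extend_eq
    ((UniformSpace.Completion.toComplL (𝕜 := ℂ) (E := H₁ ⊗[ℂ] H₂)).comp
      (TensorProduct.mapL A B)) (e := UniformSpace.Completion.toComplL)
    UniformSpace.Completion.denseRange_coe
    (UniformSpace.Completion.isUniformInducing_coe _) (h₁ ⊗ₜ[ℂ] h₂)
  exact h

end Hilbert

section Values

variable {X : Type u} {Y : Type v}

/-- Quantum distributions `P(a,b|x,y) = tr ((E_x^a ⊗ F_y^b) ρ)`, over all Hilbert spaces. -/
def IsQuantum (P : Behaviour X Y) : Prop :=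
  ∃ (H₁ H₂ : Type) (_ : NormedAddCommGroup H₁) (_ : InnerProductSpace ℂ H₁) (_ : CompleteSpace H₁)
    (_ : NormedAddCommGroup H₂) (_ : InnerProductSpace ℂ H₂) (_ : CompleteSpace H₂)
    (ρ : HilbertTensor H₁ H₂ →L[ℂ] HilbertTensor H₁ H₂)
    (E : X → ℤˣ → (H₁ →L[ℂ] H₁)) (F : Y → ℤˣ → (H₂ →L[ℂ] H₂)),
    IsDensityOperator ρ ∧ (∀ x, IsPOVM (E x)) ∧ (∀ y, IsPOVM (F y)) ∧
    ∀ a b x y, (P a b x y : ℂ) = opTrace ((tensorOp (E x a) (F y b)).comp ρ)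

/-! ### One-way communication from Alice to Bob, with shared randomness -/

/-- Distributions reachable with shared randomness and one message from an alphabet of `k` symbols
(`log k` bits) sent by Alice: Alice's answer `α` and message `m` depend on her input and the
randomness, Bob's answer `β` on his input, the randomness and the message. -/
def IsOneWayClassical (k : ℕ) (P : Behaviour X Y) : Prop :=
  ∃ (Ω : Type) (_ : MeasurableSpace Ω) (μ : MeasureTheory.Measure Ω)
    (α : X → Ω → ℤˣ) (m : X → Ω → Fin k) (β : Y → Ω → Fin k → ℤˣ),
    MeasureTheory.IsProbabilityMeasure μ ∧
    (∀ x a, MeasurableSet {ω | α x ω = a}) ∧ (∀ x j, MeasurableSet {ω | m x ω = j}) ∧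
    (∀ y j b, MeasurableSet {ω | β y ω j = b}) ∧
    ∀ a b x y, P a b x y = ∫ ω, (if α x ω = a ∧ β y ω (m x ω) = b then (1 : ℝ) else 0) ∂μ

/-- Distributions reachable with shared randomness and one `d`-dimensional quantum state
(`log d` qubits) sent by Alice, without shared entanglement: Alice's answer `α` and the state `ρ`
depend on her input and the randomness, and Bob measures `ρ` with a two-outcome POVM `F` that
depends on his input and the randomness. -/
def IsOneWayQuantum (d : ℕ) (P : Behaviour X Y) : Prop :=
  ∃ (Ω : Type) (_ : MeasurableSpace Ω) (μ : MeasureTheory.Measure Ω)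
    (α : X → Ω → ℤˣ) (ρ : X → Ω → Matrix (Fin d) (Fin d) ℂ)
    (F : Y → Ω → ℤˣ → Matrix (Fin d) (Fin d) ℂ),
    MeasureTheory.IsProbabilityMeasure μ ∧
    (∀ x a, MeasurableSet {ω | α x ω = a}) ∧ (∀ x i j, Measurable fun ω => ρ x ω i j) ∧
    (∀ y b i j, Measurable fun ω => F y ω b i j) ∧
    (∀ x ω, (ρ x ω).PosSemidef ∧ (ρ x ω).trace = 1) ∧
    (∀ y ω, (∀ b, (F y ω b).PosSemidef) ∧ ∑ b, F y ω b = 1) ∧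
    ∀ a b x y, P a b x y = ∫ ω, (if α x ω = a then (F y ω b * ρ x ω).trace.re else 0) ∂μ

end Values

/-! ### XOR games -/

/-- An XOR game: a probability distribution on pairs of inputs and a `±1`-valued predicate. -/
structure XORGame (X : Type u) (Y : Type v) [Fintype X] [Fintype Y] where
  prob : X → Y → ℝ
  pred : X → Y → ℤˣ
  prob_nonneg : ∀ x y, 0 ≤ prob x y
  prob_sum : ∑ x, ∑ y, prob x y = 1

namespace XORGame

variable {X : Type u} {Y : Type v} [Fintype X] [Fintype Y]

/-- The coefficients `T_{x,y} = π(x,y) f(x,y)`. -/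
def coeff (G : XORGame X Y) (x : X) (y : Y) : ℝ := G.prob x y * signVal (G.pred x y)

/-- The Bell functional `π(x,y) a b f(x,y)` of the game. -/
def functional (G : XORGame X Y) : BellFunctional X Y :=
  fun a b x y => G.prob x y * signVal a * signVal b * signVal (G.pred x y)

/-- The classical value `ω(G)`. -/
def classicalValue (G : XORGame X Y) : ℝ := bellValue G.functional {P | IsClassical P}

/-- The quantum (entangled) value `ω*(G)`. -/
def quantumValue (G : XORGame X Y) : ℝ := bellValue G.functional {P | IsQuantum P}

/-- The value with one-way classical communication of `log k` bits. -/
def oneWayClassicalValue (G : XORGame X Y) (k : ℕ) : ℝ :=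
  bellValue G.functional {P | IsOneWayClassical k P}

/-- The value with one-way quantum communication of `log d` qubits. -/
def oneWayQuantumValue (G : XORGame X Y) (d : ℕ) : ℝ :=
  bellValue G.functional {P | IsOneWayQuantum d P}

end XORGame

/-! ### The real Grothendieck constant -/

/-- `K` is admissible in the real Grothendieck inequality (all matrix sizes, all real Hilbert
spaces). -/
def IsGrothendieckBound (K : ℝ) : Prop :=
  ∀ (p q : ℕ) (T : Matrix (Fin p) (Fin q) ℝ),
    (∀ (t : Fin p → ℤˣ) (s : Fin q → ℤˣ), |∑ i, ∑ j, T i j * signVal (t i) * signVal (s j)| ≤ 1) →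
    ∀ (H : Type) (_ : NormedAddCommGroup H) (_ : InnerProductSpace ℝ H) (_ : CompleteSpace H)
      (w : Fin p → H) (z : Fin q → H), (∀ i, ‖w i‖ ≤ 1) → (∀ j, ‖z j‖ ≤ 1) →
      |∑ i, ∑ j, T i j * inner ℝ (w i) (z j)| ≤ K

/-- The real Grothendieck constant: the least admissible `K`. -/
def realGrothendieckConstant : ℝ := sInf {K : ℝ | IsGrothendieckBound K}

/-! ### The game with coefficients proportional to `∑_{i,j} x_i z_j y_{ij}` -/

/-- Alice's inputs: pairs `(x, z)` of sign vectors. -/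
abbrev AliceInput (n : ℕ) := (Fin n → ℤˣ) × (Fin n → ℤˣ)

/-- Bob's inputs: sign matrices. -/
abbrev BobInput (n : ℕ) := Fin n × Fin n → ℤˣ

/-- `∑_{i,j} x_i z_j y_{ij}`. -/
def triSum {n : ℕ} (w : AliceInput n) (y : BobInput n) : ℝ :=
  ∑ i, ∑ j, signVal (w.1 i) * signVal (w.2 j) * signVal (y (i, j))

/-- The normalization `M = ∑ |∑_{i,j} x_i z_j y_{ij}|` over all inputs. -/
def triNorm (n : ℕ) : ℝ := ∑ w : AliceInput n, ∑ y : BobInput n, |triSum w y|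

theorem triNorm_pos {n : ℕ} (hn : 0 < n) : 0 < triNorm n := by
  have hle : |triSum (1 : AliceInput n) (1 : BobInput n)| ≤ triNorm n :=
    (Finset.single_le_sum (f := fun y : BobInput n => |triSum (1 : AliceInput n) y|)
      (fun y _ => abs_nonneg _) (Finset.mem_univ 1)).trans
    (Finset.single_le_sum (f := fun w : AliceInput n => ∑ y : BobInput n, |triSum w y|)
      (fun w _ => Finset.sum_nonneg fun y _ => abs_nonneg _) (Finset.mem_univ 1))
  refine lt_of_lt_of_le ?_ hle
  have h : triSum (1 : AliceInput n) (1 : BobInput n) = (n : ℝ) * n := by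
    simp [triSum, signVal]
  rw [h]
  positivity

/-- The XOR game `G_n`: `π = |∑ x_i z_j y_{ij}| / M`, `f = sign (∑ x_i z_j y_{ij})` (the sign of `0`
is taken to be `1`, where `π` vanishes). -/
def rademacherGame (n : ℕ) (hn : 0 < n) : XORGame (AliceInput n) (BobInput n) where
  prob w y := |triSum w y| / triNorm n
  pred w y := if 0 ≤ triSum w y then 1 else -1
  prob_nonneg w y := div_nonneg (abs_nonneg _) (triNorm_pos hn).le
  prob_sum := by
    simp_rw [← Finset.sum_div]
    exact div_self (triNorm_pos hn).ne'

end

open scoped BigOperators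

/-! ### Rademacher sums -/

section Rademacher

/-! A payoff depends on a strategy only through the correlations of the two outputs, and it is
linear in them, so shared randomness can be fixed (`abs_bellPairing_le_of_integral`). Everything
reduces to estimates for deterministic families of signs, states and observables.

For the game `G_n`, let `N` be the number of pairs of inputs. Second and fourth moments of
Rademacher sums place the normalization `M` between `N n / 4` and `N n`. For the quantum lower
bound, let `S` be the symmetrized sign matrix of Bob. Its typical spectral scale is `√n`, so a
contraction built from `S / √(8n)` has trace pairing with `S` of order `n^(3/2)` on average
(`exists_observable`). By polarization, Alice extracts the symmetrized form in `x, z` by sending a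
normalized `x + z` or `x - z` and answering with the matching sign (`exists_state_ge`). Dividing by
`‖x‖ ‖z‖ = n` and by `M / N ~ n` leaves `1 / √n`.

For the classical upper bound, the messages cut Alice's inputs into `k` cells. Bob's average gain on
a cell is at most the `ℓ²` norm of its coefficient matrix. By duality the sum of these norms is at
most a sum, over Alice's inputs, of normalized bilinear Rademacher forms selected by the message.
Such forms have exponential tails, so choosing among `k` of them costs `O(log k)`
(`expect_abs_bilinear_le`), against a normalization of order `n`.

For the converse, an `n`-dimensional state has Hilbert–Schmidt norm at most `1` and a two-outcome
observable at most `√n`. A one-way quantum correlation is thus `√n` times an inner product in a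
Euclidean unit ball, which Clifford matrices and a maximally entangled state turn into an entangled
correlation (`exists_isQuantum_correlation_eq`). In the other direction entangled correlations are
inner products of operators `T ρ^{1/2}`, so Grothendieck's inequality compares them with signs. The
constant is defined as an infimum, so the inequality is first proved with the constant `1352`; the
set of bounds is then nonempty and its infimum is itself a bound. -/

theorem sum_units_int {M : Type*} [AddCommMonoid M] (f : ℤˣ → M) : ∑ s, f s = f 1 + f (-1) := by
  rw [UnitsInt.univ, Finset.sum_pair (by decide)]

@[simp] theorem signVal_one : signVal 1 = 1 := by simp [signVal]

@[simp] theorem signVal_neg (s : ℤˣ) : signVal (-s) = -signVal s := by simp [signVal]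

@[simp] theorem signVal_mul (s t : ℤˣ) : signVal (s * t) = signVal s * signVal t := by
  simp [signVal]

@[simp] theorem signVal_mul_self (s : ℤˣ) : signVal s * signVal s = 1 := by
  rcases Int.units_eq_one_or s with rfl | rfl <;> simp

@[simp] theorem signVal_sq (s : ℤˣ) : signVal s ^ 2 = 1 := by
  rw [sq, signVal_mul_self]

@[simp] theorem abs_signVal (s : ℤˣ) : |signVal s| = 1 := by
  rcases Int.units_eq_one_or s with rfl | rfl <;> simp

theorem exists_signVal_mul_eq_abs (r : ℝ) : ∃ s : ℤˣ, signVal s * r = |r| := by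
  rcases le_total 0 r with h | h
  · exact ⟨1, by simp [abs_of_nonneg h]⟩
  · exact ⟨-1, by simp [abs_of_nonpos h]⟩

variable {ι : Type*} [Fintype ι] [DecidableEq ι]

theorem expect_signVal_mul (i j : ι) :
    𝔼 ε : ι → ℤˣ, signVal (ε i) * signVal (ε j) = if i = j then 1 else 0 := by
  split_ifs with h
  · subst h
    simp
  -- Flipping the sign at `i` permutes the sign vectors and negates the product, so the mean equals
  -- its own negative.
  · have key := Fintype.expect_equiv (Equiv.mulLeft (Pi.mulSingle i (-1) : ι → ℤˣ))
      (fun ε => -(signVal (ε i) * signVal (ε j))) (fun ε => signVal (ε i) * signVal (ε j))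
      (fun ε => by
        simp [Pi.mulSingle_eq_of_ne (Ne.symm h)])
    rw [Finset.expect_neg_distrib] at key
    linarith

theorem expect_rademacher_mul (a b : ι → ℝ) :
    𝔼 ε : ι → ℤˣ, (∑ i, a i * signVal (ε i)) * (∑ j, b j * signVal (ε j)) = ∑ i, a i * b i := by
  simp_rw [Finset.sum_mul_sum, Finset.expect_sum_comm]
  have h : ∀ i j, 𝔼 ε : ι → ℤˣ, a i * signVal (ε i) * (b j * signVal (ε j)) =
      if i = j then a i * b j else 0 := by
    intro i j
    have : ∀ ε : ι → ℤˣ, a i * signVal (ε i) * (b j * signVal (ε j)) =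
        (a i * b j) * (signVal (ε i) * signVal (ε j)) := fun ε => by ring
    simp_rw [this, ← Finset.mul_expect, expect_signVal_mul]
    simp
  simp_rw [h]
  simp

theorem expect_rademacher_sq (a : ι → ℝ) :
    𝔼 ε : ι → ℤˣ, (∑ i, a i * signVal (ε i)) ^ 2 = ∑ i, a i ^ 2 := by
  simp_rw [sq, expect_rademacher_mul]

/-- Independence factors the exponential moment into a product of `cosh (a i)`, and `cosh u ≤ exp
(u² / 2)`. -/
theorem expect_exp_rademacher_le (a : ι → ℝ) :
    𝔼 ε : ι → ℤˣ, Real.exp (∑ i, a i * signVal (ε i)) ≤ Real.exp ((∑ i, a i ^ 2) / 2) := by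
  have h1 : ∑ ε : ι → ℤˣ, Real.exp (∑ i, a i * signVal (ε i)) =
      ∏ i, ∑ s : ℤˣ, Real.exp (a i * signVal s) := by
    rw [Finset.prod_univ_sum, Fintype.piFinset_univ]
    simp_rw [Real.exp_sum]
  have h2 : ∀ i, ∑ s : ℤˣ, Real.exp (a i * signVal s) = 2 * Real.cosh (a i) := by
    intro i
    rw [sum_units_int, Real.cosh_eq]
    simp
    ring
  rw [Fintype.expect_eq_sum_div_card, h1]
  simp_rw [h2]
  rw [Finset.prod_mul_distrib, Finset.prod_const, Fintype.card_fun, Fintype.card_units_int,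
    Finset.card_univ]
  push_cast
  rw [mul_div_cancel_left₀ _ (by positivity), Finset.sum_div, Real.exp_sum]
  exact Finset.prod_le_prod (fun i _ => (Real.cosh_pos _).le) fun i _ => Real.cosh_le_exp_half_sq _

/-- One term of the power series of `cosh`, whose terms are all nonnegative. -/
theorem pow_four_le_cosh (x : ℝ) : x ^ 4 ≤ 24 * Real.cosh x := by
  have h := le_hasSum (Real.hasSum_cosh x) 2 fun j _ => by
    rw [pow_mul]
    positivity
  norm_num [Nat.factorial] at h
  linarith

/-- Fourth moments of Rademacher sums are bounded. -/
theorem expect_rademacher_pow_four_le (a : ι → ℝ) (ha : ∑ i, a i ^ 2 ≤ 1) :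
    𝔼 ε : ι → ℤˣ, (∑ i, a i * signVal (ε i)) ^ 4 ≤ 12 := by
  have hexp : Real.exp 2 ≤ 8 := by
    have h := Real.exp_one_lt_d9
    have h2 : Real.exp 2 = Real.exp 1 ^ 2 := by
      rw [← Real.exp_nat_mul]; norm_num
    nlinarith [Real.exp_pos 1]
  have key : ∀ c : ℝ, c ^ 2 = 4 → 𝔼 ε : ι → ℤˣ, Real.exp (c * ∑ i, a i * signVal (ε i)) ≤ 8 := by
    intro c hc
    have h := expect_exp_rademacher_le fun i => c * a i
    simp_rw [mul_assoc, ← Finset.mul_sum, mul_pow, ← Finset.mul_sum, hc] at h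
    refine h.trans ((Real.exp_le_exp.2 ?_).trans hexp)
    linarith
  calc 𝔼 ε : ι → ℤˣ, (∑ i, a i * signVal (ε i)) ^ 4
      ≤ 𝔼 ε : ι → ℤˣ, (3 / 4 * Real.exp (2 * ∑ i, a i * signVal (ε i)) +
          3 / 4 * Real.exp (-2 * ∑ i, a i * signVal (ε i))) := by
        refine Finset.expect_le_expect fun ε _ => ?_
        -- Evaluating at `2 S` gives `16 S⁴ ≤ 12 (exp (2 S) + exp (-2 S))`; each exponential has
        -- mean at most `e² ≤ 8`.
        have h := pow_four_le_cosh (2 * ∑ i, a i * signVal (ε i))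
        rw [Real.cosh_eq, ← neg_mul, mul_pow] at h
        linarith
    _ ≤ 12 := by
        rw [Finset.expect_add_distrib, ← Finset.mul_expect, ← Finset.mul_expect]
        linarith [key 2 (by norm_num), key (-2) (by norm_num)]

theorem integral_exp_quadratic {b : ℝ} (hb : 0 < b) (c : ℝ) :
    ∫ g : ℝ, Real.exp (-b * g ^ 2 + c * g) = √(Real.pi / b) * Real.exp (c ^ 2 / (4 * b)) := by
  have h : ∀ g : ℝ, Real.exp (-b * g ^ 2 + c * g) =
      Real.exp (-b * (g - c / (2 * b)) ^ 2) * Real.exp (c ^ 2 / (4 * b)) := by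
    intro g
    rw [← Real.exp_add]
    congr 1
    field_simp
    ring
  simp_rw [h]
  rw [MeasureTheory.integral_mul_const,
    MeasureTheory.integral_sub_right_eq_self (fun g : ℝ => Real.exp (-b * g ^ 2)) (c / (2 * b)),
    integral_gaussian]

theorem integrable_exp_quadratic {b : ℝ} (hb : 0 < b) (c : ℝ) :
    MeasureTheory.Integrable fun g : ℝ => Real.exp (-b * g ^ 2 + c * g) := by
  -- The Bochner integral of a non-integrable function is `0`, so the positive value just computed
  -- forces integrability.
  refine MeasureTheory.Integrable.of_integral_ne_zero ?_
  rw [integral_exp_quadratic hb]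
  have := Real.pi_pos
  positivity

/-- Rademacher sums are sub-Gaussian. -/
theorem expect_exp_rademacher_sq_le (a : ι → ℝ) (ha : ∑ i, a i ^ 2 ≤ 1) :
    𝔼 ε : ι → ℤˣ, Real.exp ((∑ i, a i * signVal (ε i)) ^ 2 / 8) ≤ 2 := by
  have hpi := Real.pi_pos
  -- Gaussian linearization: `exp (S² / 8)` is an average of `exp (g S / 2)` over a Gaussian `g`.
  -- The square disappears and the exponential moment bound applies for each `g`, leaving a Gaussian
  -- integral with exponent `3/8`; the loss is `√(4/3) ≤ 2`.
  have h1 : ∀ S : ℝ, √(Real.pi / (1 / 2)) * Real.exp (S ^ 2 / 8) =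
      ∫ g : ℝ, Real.exp (-(1 / 2) * g ^ 2 + (S / 2) * g) := by
    intro S
    rw [integral_exp_quadratic (by norm_num)]
    ring_nf
  have hpt : ∀ g : ℝ, 𝔼 ε : ι → ℤˣ,
      Real.exp (-(1 / 2) * g ^ 2 + ((∑ i, a i * signVal (ε i)) / 2) * g) ≤
        Real.exp (-(3 / 8) * g ^ 2 + 0 * g) := by
    intro g
    have h := expect_exp_rademacher_le fun i => g / 2 * a i
    have h2 : ∑ i, (g / 2 * a i) ^ 2 ≤ g ^ 2 / 4 := by
      simp_rw [mul_pow]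
      rw [← Finset.mul_sum]
      nlinarith [sq_nonneg g]
    simp_rw [Real.exp_add]
    rw [← Finset.mul_expect]
    have h3 : ∀ ε : ι → ℤˣ, (∑ i, a i * signVal (ε i)) / 2 * g =
        ∑ i, g / 2 * a i * signVal (ε i) := by
      intro ε
      simp_rw [mul_assoc, ← Finset.mul_sum]
      ring
    simp_rw [h3]
    refine (mul_le_mul_of_nonneg_left h (Real.exp_pos _).le).trans ?_
    rw [← Real.exp_add, ← Real.exp_add]
    apply Real.exp_le_exp.2
    linarith
  have h4 : √(Real.pi / (1 / 2)) * 𝔼 ε : ι → ℤˣ, Real.exp ((∑ i, a i * signVal (ε i)) ^ 2 / 8) ≤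
      √(Real.pi / (3 / 8)) := by
    rw [Finset.mul_expect]
    simp_rw [h1]
    have hint : ∀ ε : ι → ℤˣ, MeasureTheory.Integrable fun g : ℝ =>
        Real.exp (-(1 / 2) * g ^ 2 + ((∑ i, a i * signVal (ε i)) / 2) * g) :=
      fun ε => integrable_exp_quadratic (by norm_num) _
    have h5 : 𝔼 ε : ι → ℤˣ, ∫ g : ℝ,
        Real.exp (-(1 / 2) * g ^ 2 + ((∑ i, a i * signVal (ε i)) / 2) * g) =
        ∫ g : ℝ, 𝔼 ε : ι → ℤˣ,
          Real.exp (-(1 / 2) * g ^ 2 + ((∑ i, a i * signVal (ε i)) / 2) * g) := by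
      simp_rw [Fintype.expect_eq_sum_div_card]
      rw [MeasureTheory.integral_div, MeasureTheory.integral_finsetSum _ fun ε _ => hint ε]
    rw [h5]
    calc _ ≤ ∫ g : ℝ, Real.exp (-(3 / 8) * g ^ 2 + 0 * g) := by
          refine MeasureTheory.integral_mono ?_ (integrable_exp_quadratic (by norm_num) _) hpt
          simp_rw [Fintype.expect_eq_sum_div_card]
          exact (MeasureTheory.integrable_finsetSum _ fun ε _ => hint ε).div_const _
      _ = _ := by rw [integral_exp_quadratic (by norm_num)]; simp
  have h6 : √(Real.pi / (3 / 8)) ≤ √(Real.pi / (1 / 2)) * 2 := by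
    rw [show (2 : ℝ) = √4 by rw [show (4 : ℝ) = 2 ^ 2 by norm_num]; simp,
      ← Real.sqrt_mul (by positivity)]
    apply Real.sqrt_le_sqrt
    norm_num
    linarith
  exact le_of_mul_le_mul_left (h4.trans h6) (by positivity)

end Rademacher

/-! ### Grothendieck's inequality -/

section Grothendieck

/-- A bilinear form bounded by `c` on signs is bounded by `c` on the unit cube. -/
theorem abs_sum_le_of_signs {X : Type*} {Y : Type*} [Fintype X] [Fintype Y] {T : X → Y → ℝ} {c : ℝ}
    (hT : ∀ (t : X → ℤˣ) (s : Y → ℤˣ), |∑ x, ∑ y, T x y * signVal (t x) * signVal (s y)| ≤ c)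
    {a : X → ℝ} {b : Y → ℝ} (ha : ∀ x, |a x| ≤ 1) (hb : ∀ y, |b y| ≤ 1) :
    |∑ x, ∑ y, T x y * a x * b y| ≤ c := by
  -- The form is linear in each argument: take signs `t` optimal against `b`, then signs `s` optimal
  -- against `t`.
  choose t ht using fun x => exists_signVal_mul_eq_abs (∑ y, T x y * b y)
  choose s hs using fun y => exists_signVal_mul_eq_abs (∑ x, T x y * signVal (t x))
  calc |∑ x, ∑ y, T x y * a x * b y| = |∑ x, a x * ∑ y, T x y * b y| := by
        congr 1
        refine Finset.sum_congr rfl fun x _ => ?_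
        rw [Finset.mul_sum]
        exact Finset.sum_congr rfl fun y _ => by ring
    _ ≤ ∑ x, |∑ y, T x y * b y| := by
        refine (Finset.abs_sum_le_sum_abs _ _).trans (Finset.sum_le_sum fun x _ => ?_)
        rw [abs_mul]
        exact mul_le_of_le_one_left (abs_nonneg _) (ha x)
    _ = ∑ y, b y * ∑ x, T x y * signVal (t x) := by
        simp_rw [← ht, Finset.mul_sum]
        rw [Finset.sum_comm]
        exact Finset.sum_congr rfl fun y _ => Finset.sum_congr rfl fun x _ => by ring
    _ ≤ ∑ y, |∑ x, T x y * signVal (t x)| := by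
        refine Finset.sum_le_sum fun y _ => (le_abs_self _).trans ?_
        rw [abs_mul]
        exact mul_le_of_le_one_left (abs_nonneg _) (hb y)
    _ = ∑ x, ∑ y, T x y * signVal (t x) * signVal (s y) := by
        simp_rw [← hs, Finset.mul_sum]
        rw [Finset.sum_comm]
        exact Finset.sum_congr rfl fun y _ => Finset.sum_congr rfl fun x _ => by ring
    _ ≤ c := (le_abs_self _).trans (hT t s)

/-- Truncation of a real number to `[-r, r]`. -/
def clip (r x : ℝ) : ℝ := max (-r) (min r x)

theorem abs_clip_le {r : ℝ} (hr : 0 ≤ r) (x : ℝ) : |clip r x| ≤ r := by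
  rw [abs_le]
  exact ⟨le_max_left _ _, max_le (by linarith) (min_le_left _ _)⟩

theorem clip_sq_le {r : ℝ} (hr : 0 ≤ r) (x : ℝ) : clip r x ^ 2 ≤ x ^ 2 := by
  rw [clip]
  rcases le_total r x with h | h
  · rw [min_eq_left h, max_eq_right (by linarith)]
    nlinarith
  · rw [min_eq_right h]
    rcases le_total (-r) x with h' | h'
    · rw [max_eq_right h']
    · rw [max_eq_left h']
      nlinarith

/-- Where the excess is nonzero, `|x| > r` and hence `|x| - r ≤ x² / r`. A fourth moment thus
controls the `L²` norm of the truncated tail. -/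
theorem sub_clip_sq_le {r : ℝ} (hr : 0 < r) (x : ℝ) : (x - clip r x) ^ 2 ≤ x ^ 4 / r ^ 2 := by
  rw [le_div_iff₀ (by positivity), ← mul_pow, show x ^ 4 = (x ^ 2) ^ 2 by ring]
  apply sq_le_sq'
  all_goals
    rw [clip]
    rcases le_total r x with h | h
    · rw [min_eq_left h, max_eq_right (by linarith)]
      nlinarith
    · rw [min_eq_right h]
      rcases le_total (-r) x with h' | h'
      · rw [max_eq_right h']
        nlinarith
      · rw [max_eq_left h']
        nlinarith

variable {p q : ℕ}

/-- Values of the bilinear form `T` on finite-dimensional vectors of norm at most one. -/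
def vectorValues (T : Fin p → Fin q → ℝ) : Set ℝ :=
  {r | ∃ (κ : Type) (_ : Fintype κ) (a : Fin p → κ → ℝ) (b : Fin q → κ → ℝ),
    (∀ i, ∑ k, a i k ^ 2 ≤ 1) ∧ (∀ j, ∑ k, b j k ^ 2 ≤ 1) ∧
    r = |∑ i, ∑ j, T i j * ∑ k, a i k * b j k|}

theorem abs_sum_mul_le_one {κ : Type*} [Fintype κ] {a b : κ → ℝ} (ha : ∑ k, a k ^ 2 ≤ 1)
    (hb : ∑ k, b k ^ 2 ≤ 1) : |∑ k, a k * b k| ≤ 1 := by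
  rw [← sq_le_one_iff_abs_le_one]
  exact (Finset.sum_mul_sq_le_sq_mul_sq _ a b).trans
    (mul_le_one₀ ha (Finset.sum_nonneg fun _ _ => sq_nonneg _) hb)

theorem bddAbove_vectorValues (T : Fin p → Fin q → ℝ) : BddAbove (vectorValues T) := by
  refine ⟨∑ i, ∑ j, |T i j|, ?_⟩
  rintro r ⟨κ, _, a, b, ha, hb, rfl⟩
  refine (Finset.abs_sum_le_sum_abs _ _).trans (Finset.sum_le_sum fun i _ => ?_)
  refine (Finset.abs_sum_le_sum_abs _ _).trans (Finset.sum_le_sum fun j _ => ?_)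
  rw [abs_mul]
  exact mul_le_of_le_one_right (abs_nonneg _) (abs_sum_mul_le_one (ha i) (hb j))

/-- Functions in the unit ball of `L²` of a uniform finite space are unit-ball vectors after
division by `√|Ω|`. The supremum ranges over all dimensions so that it also covers random variables
built from the original vectors. -/
theorem abs_expect_le_sSup_vectorValues (T : Fin p → Fin q → ℝ) {Ω : Type} [Fintype Ω]
    [Nonempty Ω] {a : Fin p → Ω → ℝ} {b : Fin q → Ω → ℝ}
    (ha : ∀ i, 𝔼 ω, a i ω ^ 2 ≤ 1) (hb : ∀ j, 𝔼 ω, b j ω ^ 2 ≤ 1) :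
    |𝔼 ω, ∑ i, ∑ j, T i j * (a i ω * b j ω)| ≤ sSup (vectorValues T) := by
  have hN : (0 : ℝ) < Fintype.card Ω := by exact_mod_cast Fintype.card_pos
  have hs : √(Fintype.card Ω : ℝ) ^ 2 = Fintype.card Ω := Real.sq_sqrt hN.le
  refine le_csSup (bddAbove_vectorValues T) ⟨Ω, inferInstance,
    fun i ω => a i ω / √(Fintype.card Ω : ℝ), fun j ω => b j ω / √(Fintype.card Ω : ℝ), ?_, ?_, ?_⟩
  · intro i
    have := ha i
    rw [Fintype.expect_eq_sum_div_card] at this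
    simp_rw [div_pow, hs, ← Finset.sum_div]
    exact this
  · intro i
    have := hb i
    rw [Fintype.expect_eq_sum_div_card] at this
    simp_rw [div_pow, hs, ← Finset.sum_div]
    exact this
  · congr 1
    simp_rw [Finset.expect_sum_comm, ← Finset.mul_expect]
    refine Finset.sum_congr rfl fun i _ => Finset.sum_congr rfl fun j _ => ?_
    rw [Fintype.expect_eq_sum_div_card, Finset.sum_div]
    congr 1
    refine Finset.sum_congr rfl fun ω _ => ?_
    rw [div_mul_div_comm, ← sq, hs]

/-- A self-improving bound. Vectors become Rademacher sums with the same inner products, truncated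
at `26`. The product of the two truncations costs `26² = 676`; the two terms containing a tail cost
at most a quarter of the supremum `K` each. Since `K` is finite, `K ≤ 676 + K / 2` gives `K ≤ 1352`.
-/
theorem sSup_vectorValues_le (T : Fin p → Fin q → ℝ)
    (hT : ∀ (t : Fin p → ℤˣ) (s : Fin q → ℤˣ),
      |∑ i, ∑ j, T i j * signVal (t i) * signVal (s j)| ≤ 1) :
    sSup (vectorValues T) ≤ 1352 := by
  set K := sSup (vectorValues T) with hK
  suffices h : K ≤ 676 + K / 4 + K / 4 by linarith
  refine csSup_le ⟨_, Empty, inferInstance, fun _ => 0, fun _ => 0, by simp, by simp, rfl⟩ ?_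
  rintro r ⟨κ, _, a, b, ha, hb, rfl⟩
  classical
  let A : Fin p → (κ → ℤˣ) → ℝ := fun i ε => ∑ k, a i k * signVal (ε k)
  let B : Fin q → (κ → ℤˣ) → ℝ := fun j ε => ∑ k, b j k * signVal (ε k)
  have hA2 : ∀ i, 𝔼 ε, A i ε ^ 2 ≤ 1 := fun i => (expect_rademacher_sq (a i)).trans_le (ha i)
  have hB2 : ∀ j, 𝔼 ε, B j ε ^ 2 ≤ 1 := fun j => (expect_rademacher_sq (b j)).trans_le (hb j)
  have hclip : ∀ (f : (κ → ℤˣ) → ℝ), 𝔼 ε, f ε ^ 2 ≤ 1 → 𝔼 ε, clip 26 (f ε) ^ 2 ≤ 1 :=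
    fun f hf => (Finset.expect_le_expect fun ε _ => clip_sq_le (by norm_num) _).trans hf
  -- Four times the tail is still in the unit ball: `16 / 26² ≤ 1 / 40` and `12 / 40 ≤ 1`. The
  -- factor `4` yields the quarter of `K`.
  have hrest : ∀ (f : (κ → ℤˣ) → ℝ), 𝔼 ε, f ε ^ 4 ≤ 12 →
      𝔼 ε, (4 * (f ε - clip 26 (f ε))) ^ 2 ≤ 1 := by
    intro f hf
    calc 𝔼 ε, (4 * (f ε - clip 26 (f ε))) ^ 2 ≤ 𝔼 ε, (1 / 40) * f ε ^ 4 := by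
          refine Finset.expect_le_expect fun ε _ => ?_
          have h := sub_clip_sq_le (r := 26) (by norm_num) (f ε)
          have h4 : 0 ≤ f ε ^ 4 := by positivity
          rw [mul_pow]
          norm_num at h ⊢
          linarith
      _ ≤ 1 := by
          rw [← Finset.mul_expect]
          linarith
  have hdecomp : ∑ i, ∑ j, T i j * ∑ k, a i k * b j k =
      𝔼 ε, ∑ i, ∑ j, T i j * (clip 26 (A i ε) * clip 26 (B j ε)) +
      (𝔼 ε, ∑ i, ∑ j, T i j * (clip 26 (A i ε) * (4 * (B j ε - clip 26 (B j ε))))) / 4 +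
      (𝔼 ε, ∑ i, ∑ j, T i j * (4 * (A i ε - clip 26 (A i ε)) * B j ε)) / 4 := by
    rw [Finset.expect_div, Finset.expect_div, ← Finset.expect_add_distrib,
      ← Finset.expect_add_distrib]
    have h : ∀ i j, ∑ k, a i k * b j k = 𝔼 ε, A i ε * B j ε :=
      fun i j => (expect_rademacher_mul (a i) (b j)).symm
    simp_rw [h, Finset.mul_expect, ← Finset.expect_sum_comm]
    refine Finset.expect_congr rfl fun ε _ => ?_
    simp_rw [Finset.sum_div, ← Finset.sum_add_distrib]
    refine Finset.sum_congr rfl fun i _ => Finset.sum_congr rfl fun j _ => ?_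
    ring
  rw [hdecomp]
  refine (abs_add_three _ _ _).trans (add_le_add (add_le_add ?_ ?_) ?_)
  · have hpt : ∀ ε, |∑ i, ∑ j, T i j * (clip 26 (A i ε) * clip 26 (B j ε))| ≤ 676 := by
      intro ε
      have h := abs_sum_le_of_signs hT (a := fun i => clip 26 (A i ε) / 26)
        (b := fun j => clip 26 (B j ε) / 26)
        (fun i => by
          rw [abs_div, div_le_one (by norm_num)]
          exact (abs_clip_le (by norm_num) _).trans (le_abs_self _))
        (fun j => by
          rw [abs_div, div_le_one (by norm_num)]
          exact (abs_clip_le (by norm_num) _).trans (le_abs_self _))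
      have h2 : ∑ i, ∑ j, T i j * (clip 26 (A i ε) * clip 26 (B j ε)) =
          676 * ∑ i, ∑ j, T i j * (clip 26 (A i ε) / 26) * (clip 26 (B j ε) / 26) := by
        simp_rw [Finset.mul_sum]
        refine Finset.sum_congr rfl fun i _ => Finset.sum_congr rfl fun j _ => ?_
        ring
      rw [h2, abs_mul]
      norm_num
      linarith
    refine (Finset.abs_expect_le _ _).trans ?_
    refine (Finset.expect_le_expect fun ε _ => hpt ε).trans ?_
    simp
  · rw [abs_div, abs_of_pos (by norm_num : (0 : ℝ) < 4)]
    refine div_le_div_of_nonneg_right ?_ (by norm_num)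
    exact abs_expect_le_sSup_vectorValues T (fun i => hclip _ (hA2 i))
      fun j => hrest _ (expect_rademacher_pow_four_le _ (hb j))
  · rw [abs_div, abs_of_pos (by norm_num : (0 : ℝ) < 4)]
    refine div_le_div_of_nonneg_right ?_ (by norm_num)
    exact abs_expect_le_sSup_vectorValues T
      (fun i => hrest _ (expect_rademacher_pow_four_le _ (ha i))) hB2

/-- **Grothendieck's inequality**, with a non-optimal constant. -/
theorem isGrothendieckBound_const : IsGrothendieckBound 1352 := by
  intro p q T hT H _ _ _ w z hw hz
  refine le_trans ?_ (sSup_vectorValues_le T hT)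
  -- Only the span of the finitely many vectors matters, so orthonormal coordinates reduce to the
  -- finite-dimensional supremum.
  let V : Submodule ℝ H := Submodule.span ℝ (Set.range w ∪ Set.range z)
  have : FiniteDimensional ℝ V :=
    FiniteDimensional.span_of_finite ℝ ((Set.finite_range w).union (Set.finite_range z))
  let e := stdOrthonormalBasis ℝ V
  let w' : Fin p → V := fun i => ⟨w i, Submodule.subset_span (Or.inl ⟨i, rfl⟩)⟩
  let z' : Fin q → V := fun j => ⟨z j, Submodule.subset_span (Or.inr ⟨j, rfl⟩)⟩
  have hnorm : ∀ v : V, ‖v‖ ≤ 1 → ∑ k, (inner ℝ (e k) v) ^ 2 ≤ 1 := by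
    intro v hv
    rw [e.sum_sq_inner_right]
    exact pow_le_one₀ (norm_nonneg _) hv
  refine le_csSup (bddAbove_vectorValues T) ⟨Fin (Module.finrank ℝ V), inferInstance,
    fun i k => inner ℝ (e k) (w' i), fun j k => inner ℝ (e k) (z' j),
    fun i => hnorm _ (hw i), fun j => hnorm _ (hz j), ?_⟩
  congr 1
  refine Finset.sum_congr rfl fun i _ => Finset.sum_congr rfl fun j _ => ?_
  congr 1
  have h := e.sum_inner_mul_inner (w' i) (z' j)
  rw [show inner ℝ (w i) (z j) = inner ℝ (w' i) (z' j) from rfl, ← h]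
  exact Finset.sum_congr rfl fun k _ => by rw [real_inner_comm]

theorem IsGrothendieckBound.nonneg {K : ℝ} (hK : IsGrothendieckBound K) : 0 ≤ K := by
  have h := hK 0 0 0 (by simp) ℝ inferInstance inferInstance inferInstance 0 0 (by simp) (by simp)
  simpa using h

theorem realGrothendieckConstant_nonneg : 0 ≤ realGrothendieckConstant :=
  Real.sInf_nonneg fun _ hK => IsGrothendieckBound.nonneg hK

/-- The infimum defining the Grothendieck constant is attained. -/
theorem isGrothendieckBound_realGrothendieckConstant :
    IsGrothendieckBound realGrothendieckConstant := by
  intro p q T hT H i₁ i₂ i₃ w z hw hz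
  exact le_csInf ⟨_, isGrothendieckBound_const⟩ fun K hK => hK p q T hT H i₁ i₂ i₃ w z hw hz

/-- The real Grothendieck inequality for forms indexed by arbitrary finite types. -/
theorem abs_sum_inner_le_realGrothendieckConstant {X : Type*} {Y : Type*} [Fintype X] [Fintype Y]
    {T : X → Y → ℝ} {c : ℝ} (hc : 0 < c)
    (hT : ∀ (t : X → ℤˣ) (s : Y → ℤˣ), |∑ x, ∑ y, T x y * signVal (t x) * signVal (s y)| ≤ c)
    {H : Type} [NormedAddCommGroup H] [InnerProductSpace ℝ H] [CompleteSpace H]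
    {w : X → H} {z : Y → H} (hw : ∀ x, ‖w x‖ ≤ 1) (hz : ∀ y, ‖z y‖ ≤ 1) :
    |∑ x, ∑ y, T x y * inner ℝ (w x) (z y)| ≤ realGrothendieckConstant * c := by
  let eX := Fintype.equivFin X
  let eY := Fintype.equivFin Y
  have hre : ∀ f : X → Y → ℝ, ∑ i, ∑ j, f (eX.symm i) (eY.symm j) = ∑ x, ∑ y, f x y := by
    intro f
    rw [Equiv.sum_comp eX.symm fun x => ∑ j, f x (eY.symm j)]
    exact Finset.sum_congr rfl fun x _ => Equiv.sum_comp eY.symm (f x)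
  have h := isGrothendieckBound_realGrothendieckConstant (Fintype.card X) (Fintype.card Y)
    (fun i j => T (eX.symm i) (eY.symm j) / c) ?_ H inferInstance inferInstance inferInstance
    (w ∘ eX.symm) (z ∘ eY.symm) (fun _ => hw _) fun _ => hz _
  · have h2 := hre fun x y => T x y / c * inner ℝ (w x) (z y)
    simp only [Function.comp_apply] at h
    rw [h2] at h
    have h3 : ∑ x, ∑ y, T x y / c * inner ℝ (w x) (z y) =
        (∑ x, ∑ y, T x y * inner ℝ (w x) (z y)) / c := by
      simp_rw [Finset.sum_div]
      exact Finset.sum_congr rfl fun x _ => Finset.sum_congr rfl fun y _ => by ring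
    rwa [h3, abs_div, abs_of_pos hc, div_le_iff₀ hc] at h
  · intro t s
    have h2 := hre fun x y => T x y / c * signVal (t (eX x)) * signVal (s (eY y))
    simp only [Equiv.apply_symm_apply] at h2
    rw [h2]
    have h3 : ∑ x, ∑ y, T x y / c * signVal (t (eX x)) * signVal (s (eY y)) =
        (∑ x, ∑ y, T x y * signVal (t (eX x)) * signVal (s (eY y))) / c := by
      simp_rw [Finset.sum_div]
      exact Finset.sum_congr rfl fun x _ => Finset.sum_congr rfl fun y _ => by ring
    rw [h3, abs_div, abs_of_pos hc, div_le_one hc]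
    exact hT (fun x => t (eX x)) fun y => s (eY y)

end Grothendieck

/-! ### Positive semidefinite matrices -/

section PosSemidef

open scoped MatrixOrder in
theorem Matrix.PosSemidef.exists_eq_conjTranspose_mul_self {ι 𝕜 : Type*} [Fintype ι]
    [RCLike 𝕜] {A : Matrix ι ι 𝕜} (hA : A.PosSemidef) : ∃ C : Matrix ι ι 𝕜, A = C.conjTranspose * C := by
  classical
  refine ⟨CFC.sqrt A, ?_⟩
  have h : (CFC.sqrt A).IsHermitian := (Matrix.nonneg_iff_posSemidef.1 (CFC.sqrt_nonneg A)).isHermitian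
  rw [h.eq, CFC.sqrt_mul_sqrt_self A hA.nonneg]

theorem Matrix.PosSemidef.trace_mul_nonneg {ι : Type*} [Fintype ι] {A B : Matrix ι ι ℂ}
    (hA : A.PosSemidef) (hB : B.PosSemidef) : 0 ≤ (A * B).trace := by
  obtain ⟨C, rfl⟩ := hA.exists_eq_conjTranspose_mul_self
  rw [mul_assoc, Matrix.trace_mul_comm]
  exact (hB.mul_mul_conjTranspose_same C).trace_nonneg

end PosSemidef

/-! ### Correlations and values of XOR games -/

section Values

variable {X : Type u} {Y : Type v}

/-- The expected product of the two outputs. -/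
def correlation (P : Behaviour X Y) (x : X) (y : Y) : ℝ :=
  ∑ a : ℤˣ, ∑ b : ℤˣ, signVal a * signVal b * P a b x y

theorem correlation_deterministic (t : X → ℤˣ) (s : Y → ℤˣ) (x : X) (y : Y) :
    correlation (fun a b x y => if t x = a ∧ s y = b then 1 else 0) x y =
      signVal (t x) * signVal (s y) := by
  simp only [correlation, sum_units_int]
  rcases Int.units_eq_one_or (t x) with h | h <;> rcases Int.units_eq_one_or (s y) with h' | h' <;>
    simp [h, h']

theorem isClassical_deterministic (t : X → ℤˣ) (s : Y → ℤˣ) :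
    IsClassical fun a b x y => if t x = a ∧ s y = b then 1 else 0 := by
  refine ⟨Unit, inferInstance, MeasureTheory.Measure.dirac (), fun _ x a => if t x = a then 1 else 0,
    fun _ y b => if s y = b then 1 else 0, inferInstance, by fun_prop, by fun_prop, ?_, ?_, ?_, ?_, ?_⟩
  · intro _ x a
    dsimp only
    split_ifs <;> norm_num
  · intro _ x
    simp only [Finset.sum_ite_eq, Finset.mem_univ, if_true]
  · intro _ x a
    dsimp only
    split_ifs <;> norm_num
  · intro _ x
    simp only [Finset.sum_ite_eq, Finset.mem_univ, if_true]
  · intro a b x y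
    by_cases h : t x = a <;> simp [h]

theorem isOneWayClassical_deterministic {k : ℕ} (hk : 1 ≤ k) (t : X → ℤˣ) (s : Y → ℤˣ) :
    IsOneWayClassical k fun a b x y => if t x = a ∧ s y = b then 1 else 0 := by
  exact ⟨Unit, inferInstance, MeasureTheory.Measure.dirac (), fun x _ => t x, fun _ _ => ⟨0, hk⟩,
    fun y _ _ => s y, inferInstance, by simp, by simp, by simp, by simp⟩

theorem correlation_oneWayQuantum {d : ℕ} (t : X → ℤˣ) (ρ : X → Matrix (Fin d) (Fin d) ℂ)
    (F : Y → ℤˣ → Matrix (Fin d) (Fin d) ℂ) (x : X) (y : Y) :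
    correlation (fun a b x y => if t x = a then (F y b * ρ x).trace.re else 0) x y =
      signVal (t x) * ((F y 1 - F y (-1)) * ρ x).trace.re := by
  simp only [correlation, sum_units_int, signVal_one, signVal_neg, sub_mul, Matrix.trace_sub,
      Complex.sub_re]
  rcases Int.units_eq_one_or (t x) with h | h <;> simp [h] <;> ring

theorem isOneWayQuantum_deterministic {d : ℕ} (t : X → ℤˣ) (ρ : X → Matrix (Fin d) (Fin d) ℂ)
    (F : Y → ℤˣ → Matrix (Fin d) (Fin d) ℂ)
    (hρ : ∀ x, (ρ x).PosSemidef ∧ (ρ x).trace = 1)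
    (hF : ∀ y, (∀ b, (F y b).PosSemidef) ∧ ∑ b, F y b = 1) :
    IsOneWayQuantum d fun a b x y => if t x = a then (F y b * ρ x).trace.re else 0 :=
  ⟨Unit, inferInstance, MeasureTheory.Measure.dirac (), fun x _ => t x, fun x _ => ρ x,
    fun y _ => F y, inferInstance, by simp, by fun_prop, by fun_prop, fun x _ => hρ x,
    fun y _ => hF y, by simp⟩

variable [Fintype X] [Fintype Y] (G : XORGame X Y)

theorem bellPairing_functional (P : Behaviour X Y) :
    bellPairing G.functional P = ∑ x, ∑ y, G.coeff x y * correlation P x y := by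
  simp only [bellPairing, XORGame.functional, correlation, XORGame.coeff, sum_units_int,
    ← Finset.sum_add_distrib]
  refine Finset.sum_congr rfl fun x _ => Finset.sum_congr rfl fun y _ => ?_
  ring

theorem bellValue_nonneg (B : BellFunctional X Y) (S : Set (Behaviour X Y)) :
    0 ≤ bellValue B S := by
  refine Real.sSup_nonneg ?_
  rintro r ⟨P, -, rfl⟩
  exact abs_nonneg _

/-- Nonnegativity of `c` covers an empty set of distributions, whose real supremum is `0` by
convention. -/
theorem bellValue_le {B : BellFunctional X Y} {S : Set (Behaviour X Y)} {c : ℝ} (hc : 0 ≤ c)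
    (h : ∀ P ∈ S, |bellPairing B P| ≤ c) : bellValue B S ≤ c := by
  refine Real.sSup_le ?_ hc
  rintro r ⟨P, hP, rfl⟩
  exact h P hP

/-- The bound `c` serves only to make the set bounded above; the supremum of an unbounded real set
is `0` by convention. -/
theorem le_bellValue {B : BellFunctional X Y} {S : Set (Behaviour X Y)} {c : ℝ}
    (h : ∀ P ∈ S, |bellPairing B P| ≤ c) {P : Behaviour X Y} (hP : P ∈ S) :
    |bellPairing B P| ≤ bellValue B S := by
  refine le_csSup ⟨c, ?_⟩ ⟨P, hP, rfl⟩
  rintro r ⟨P, hP, rfl⟩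
  exact h P hP

/-- The pairing is linear, so averaging over shared randomness cannot beat the best fixed `ω`. The
classical and both one-way upper bounds pass through this reduction. -/
theorem abs_bellPairing_le_of_integral {Ω : Type*} [MeasurableSpace Ω]
    {μ : MeasureTheory.Measure Ω} [MeasureTheory.IsProbabilityMeasure μ]
    {p : Ω → Behaviour X Y} {P : Behaviour X Y} {c : ℝ}
    (hint : ∀ a b x y, MeasureTheory.Integrable (fun ω => p ω a b x y) μ)
    (hP : ∀ a b x y, P a b x y = ∫ ω, p ω a b x y ∂μ)
    (hc : ∀ ω, |∑ x, ∑ y, G.coeff x y * correlation (p ω) x y| ≤ c) :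
    |bellPairing G.functional P| ≤ c := by
  have h : bellPairing G.functional P =
      ∫ ω, ∑ x, ∑ y, G.coeff x y * correlation (p ω) x y ∂μ := by
    rw [bellPairing_functional]
    simp only [correlation, hP]
    have hi : ∀ x y a b, MeasureTheory.Integrable
        (fun ω => signVal a * signVal b * p ω a b x y) μ :=
      fun x y a b => (hint a b x y).const_mul _
    have hi2 : ∀ x y a, MeasureTheory.Integrable
        (fun ω => ∑ b, signVal a * signVal b * p ω a b x y) μ :=
      fun x y a => MeasureTheory.integrable_finsetSum _ fun b _ => hi x y a b
    have hi3 : ∀ x y, MeasureTheory.Integrable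
        (fun ω => G.coeff x y * ∑ a, ∑ b, signVal a * signVal b * p ω a b x y) μ :=
      fun x y => (MeasureTheory.integrable_finsetSum _ fun a _ => hi2 x y a).const_mul _
    rw [MeasureTheory.integral_finsetSum _ fun x _ =>
      MeasureTheory.integrable_finsetSum _ fun y _ => hi3 x y]
    refine Finset.sum_congr rfl fun x _ => ?_
    rw [MeasureTheory.integral_finsetSum _ fun y _ => hi3 x y]
    refine Finset.sum_congr rfl fun y _ => ?_
    rw [MeasureTheory.integral_const_mul]
    congr 1
    rw [MeasureTheory.integral_finsetSum _ fun a _ => hi2 x y a]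
    refine Finset.sum_congr rfl fun a _ => ?_
    rw [MeasureTheory.integral_finsetSum _ fun b _ => hi x y a b]
    exact Finset.sum_congr rfl fun b _ => (MeasureTheory.integral_const_mul _ _).symm
  rw [h, ← Real.norm_eq_abs]
  refine (MeasureTheory.norm_integral_le_of_norm_le_const (C := c)
    (Filter.Eventually.of_forall hc)).trans ?_
  simp

theorem sum_abs_coeff : ∑ x, ∑ y, |G.coeff x y| = 1 := by
  rw [← G.prob_sum]
  refine Finset.sum_congr rfl fun x _ => Finset.sum_congr rfl fun y _ => ?_
  rw [XORGame.coeff, abs_mul, abs_signVal, mul_one, abs_of_nonneg (G.prob_nonneg x y)]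

theorem abs_sum_coeff_mul_le_one {c : X → Y → ℝ} (hc : ∀ x y, |c x y| ≤ 1) :
    |∑ x, ∑ y, G.coeff x y * c x y| ≤ 1 := by
  rw [← sum_abs_coeff G]
  refine (Finset.abs_sum_le_sum_abs _ _).trans (Finset.sum_le_sum fun x _ => ?_)
  refine (Finset.abs_sum_le_sum_abs _ _).trans (Finset.sum_le_sum fun y _ => ?_)
  rw [abs_mul]
  exact mul_le_of_le_one_right (abs_nonneg _) (hc x y)

/-! #### Classical distributions -/

variable {G}

theorem abs_bellPairing_le_of_isClassical {c : ℝ}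
    (hc : ∀ (t : X → ℤˣ) (s : Y → ℤˣ),
      |∑ x, ∑ y, G.coeff x y * signVal (t x) * signVal (s y)| ≤ c)
    {P : Behaviour X Y} (hP : IsClassical P) : |bellPairing G.functional P| ≤ c := by
  obtain ⟨Ω, _, μ, p, q, hμ, hpm, hqm, hp0, hp1, hq0, hq1, hP⟩ := hP
  have hple : ∀ ω x a, p ω x a ≤ 1 := fun ω x a =>
    (Finset.single_le_sum (fun a _ => hp0 ω x a) (Finset.mem_univ a)).trans_eq (hp1 ω x)
  have hqle : ∀ ω y b, q ω y b ≤ 1 := fun ω y b =>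
    (Finset.single_le_sum (fun b _ => hq0 ω y b) (Finset.mem_univ b)).trans_eq (hq1 ω y)
  refine abs_bellPairing_le_of_integral G (p := fun ω a b x y => p ω x a * q ω y b)
    (fun a b x y => ?_) hP fun ω => ?_
  · refine MeasureTheory.Integrable.of_bound ((hpm x a).mul (hqm y b)).aestronglyMeasurable 1
      (Filter.Eventually.of_forall fun ω => ?_)
    rw [Real.norm_eq_abs, abs_of_nonneg (mul_nonneg (hp0 _ _ _) (hq0 _ _ _))]
    exact mul_le_one₀ (hple _ _ _) (hq0 _ _ _) (hqle _ _ _)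
  · have h := abs_sum_le_of_signs hc (a := fun x => p ω x 1 - p ω x (-1))
      (b := fun y => q ω y 1 - q ω y (-1))
      (fun x => abs_sub_le_of_nonneg_of_le (hp0 _ _ _) (hple _ _ _) (hp0 _ _ _) (hple _ _ _))
      (fun y => abs_sub_le_of_nonneg_of_le (hq0 _ _ _) (hqle _ _ _) (hq0 _ _ _) (hqle _ _ _))
    refine le_of_eq_of_le ?_ h
    congr 1
    refine Finset.sum_congr rfl fun x _ => Finset.sum_congr rfl fun y _ => ?_
    simp only [correlation, sum_units_int, signVal_one, signVal_neg]
    ring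

theorem abs_sum_coeff_signVal_le_one (t : X → ℤˣ) (s : Y → ℤˣ) :
    |∑ x, ∑ y, G.coeff x y * signVal (t x) * signVal (s y)| ≤ 1 := by
  simp_rw [mul_assoc]
  exact abs_sum_coeff_mul_le_one G fun x y => by simp [abs_mul]

theorem abs_sum_coeff_signVal_le_classicalValue (t : X → ℤˣ) (s : Y → ℤˣ) :
    |∑ x, ∑ y, G.coeff x y * signVal (t x) * signVal (s y)| ≤ G.classicalValue := by
  have h := le_bellValue (B := G.functional)
    (fun P hP => abs_bellPairing_le_of_isClassical (abs_sum_coeff_signVal_le_one (G := G)) hP)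
    (isClassical_deterministic t s)
  rw [bellPairing_functional] at h
  simp_rw [correlation_deterministic, ← mul_assoc] at h
  exact h

variable (G) in
-- The second moment of a Rademacher sum is the sum of squares of its coefficients. If the form
-- vanished on all signs, this applied in `s` and then in `t` would kill every coefficient, although
-- their absolute values sum to `1`.
theorem exists_sum_coeff_signVal_ne_zero : ∃ (t : X → ℤˣ) (s : Y → ℤˣ),
    ∑ x, ∑ y, G.coeff x y * signVal (t x) * signVal (s y) ≠ 0 := by
  classical
  by_contra! h
  have hs : ∀ t : X → ℤˣ, ∀ y, ∑ x, G.coeff x y * signVal (t x) = 0 := by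
    intro t y
    have h2 := expect_rademacher_sq fun y => ∑ x, G.coeff x y * signVal (t x)
    have h3 : ∀ s : Y → ℤˣ, ∑ y, (∑ x, G.coeff x y * signVal (t x)) * signVal (s y) = 0 := by
      intro s
      rw [← h t s, Finset.sum_comm]
      simp_rw [Finset.sum_mul]
    simp only [h3] at h2
    simp only [ne_eq, OfNat.ofNat_ne_zero, not_false_eq_true, zero_pow, Finset.expect_const_zero]
      at h2
    have h4 := (Finset.sum_eq_zero_iff_of_nonneg fun y _ => sq_nonneg _).1 h2.symm y
      (Finset.mem_univ y)
    exact pow_eq_zero_iff two_ne_zero |>.1 h4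
  have hz : ∀ x y, G.coeff x y = 0 := by
    intro x y
    have h2 := expect_rademacher_sq fun x => G.coeff x y
    simp only [hs, ne_eq, OfNat.ofNat_ne_zero, not_false_eq_true, zero_pow,
      Finset.expect_const_zero] at h2
    have h4 := (Finset.sum_eq_zero_iff_of_nonneg fun y _ => sq_nonneg _).1 h2.symm x
      (Finset.mem_univ x)
    exact pow_eq_zero_iff two_ne_zero |>.1 h4
  have h1 := sum_abs_coeff G
  simp [hz] at h1

variable (G) in
theorem classicalValue_pos : 0 < G.classicalValue := by
  obtain ⟨t, s, h⟩ := exists_sum_coeff_signVal_ne_zero G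
  exact (abs_pos.2 h).trans_le (abs_sum_coeff_signVal_le_classicalValue t s)

/-! #### One-way classical communication -/

theorem abs_bellPairing_le_of_isOneWayClassical {k : ℕ} {c : ℝ}
    (hc : ∀ (t : X → ℤˣ) (m : X → Fin k) (s : Y → Fin k → ℤˣ),
      |∑ x, ∑ y, G.coeff x y * (signVal (t x) * signVal (s y (m x)))| ≤ c)
    {P : Behaviour X Y} (hP : IsOneWayClassical k P) : |bellPairing G.functional P| ≤ c := by
  obtain ⟨Ω, _, μ, α, m, β, hμ, hα, hm, hβ, hP⟩ := hP
  refine abs_bellPairing_le_of_integral G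
    (p := fun ω a b x y => if α x ω = a ∧ β y ω (m x ω) = b then 1 else 0)
    (fun a b x y => ?_) hP fun ω => ?_
  · have hmeas : MeasurableSet {ω | α x ω = a ∧ β y ω (m x ω) = b} := by
      -- Bob's answer is evaluated at a random message, so the event is split over the finitely many
      -- messages to see that it is measurable.
      have : {ω | α x ω = a ∧ β y ω (m x ω) = b} =
          {ω | α x ω = a} ∩ ⋃ j, {ω | m x ω = j} ∩ {ω | β y ω j = b} := by
        ext ω
        simp
      rw [this]
      exact (hα x a).inter (MeasurableSet.iUnion fun j => (hm x j).inter (hβ y j b))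
    refine MeasureTheory.Integrable.of_bound
      (Measurable.ite hmeas measurable_const measurable_const).aestronglyMeasurable 1
      (Filter.Eventually.of_forall fun ω => ?_)
    split_ifs <;> simp
  · refine le_of_eq_of_le ?_ (hc (fun x => α x ω) (fun x => m x ω) fun y j => β y ω j)
    congr 1
    refine Finset.sum_congr rfl fun x _ => Finset.sum_congr rfl fun y _ => ?_
    congr 1
    exact correlation_deterministic (fun x => α x ω) (fun y => β y ω (m x ω)) x y

/-- A deterministic classical strategy is a one-way strategy with a constant message. -/
theorem classicalValue_le_oneWayClassicalValue {k : ℕ} (hk : 1 ≤ k) :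
    G.classicalValue ≤ G.oneWayClassicalValue k := by
  refine bellValue_le (bellValue_nonneg _ _) fun P hP =>
    abs_bellPairing_le_of_isClassical (fun t s => ?_) hP
  have h := le_bellValue (B := G.functional) (c := 1)
    (fun P hP => abs_bellPairing_le_of_isOneWayClassical
      (fun t m s => abs_sum_coeff_mul_le_one G fun x y => by simp [abs_mul]) hP)
    (isOneWayClassical_deterministic hk t s)
  rw [bellPairing_functional] at h
  simp_rw [correlation_deterministic, ← mul_assoc] at h
  exact h

/-! #### One-way quantum communication -/

theorem abs_bellPairing_le_of_isOneWayQuantum {d : ℕ} {c : ℝ}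
    (hc : ∀ (t : X → ℤˣ) (ρ : X → Matrix (Fin d) (Fin d) ℂ) (F : Y → ℤˣ → Matrix (Fin d) (Fin d) ℂ),
      (∀ x, (ρ x).PosSemidef ∧ (ρ x).trace = 1) →
      (∀ y, (∀ b, (F y b).PosSemidef) ∧ ∑ b, F y b = 1) →
      |∑ x, ∑ y, G.coeff x y * (signVal (t x) * ((F y 1 - F y (-1)) * ρ x).trace.re)| ≤ c)
    {P : Behaviour X Y} (hP : IsOneWayQuantum d P) : |bellPairing G.functional P| ≤ c := by
  obtain ⟨Ω, _, μ, α, ρ, F, hμ, hα, hρm, hFm, hρ, hF, hP⟩ := hP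
  refine abs_bellPairing_le_of_integral G
    (p := fun ω a b x y => if α x ω = a then (F y ω b * ρ x ω).trace.re else 0)
    (fun a b x y => ?_) hP fun ω => ?_
  · refine MeasureTheory.Integrable.of_bound
      (Measurable.ite (hα x a) ?_ measurable_const).aestronglyMeasurable 1
      (Filter.Eventually.of_forall fun ω => ?_)
    · simp only [Matrix.trace, Matrix.diag, Matrix.mul_apply]
      refine Complex.measurable_re.comp ?_
      exact Finset.measurable_sum _ fun i _ => Finset.measurable_sum _ fun j _ =>
        (hFm y b i j).mul (hρm x j i)
    · split_ifs
      · have h0 : ∀ b, 0 ≤ (F y ω b * ρ x ω).trace.re := fun b =>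
          (Complex.le_def.1 (((hF y ω).1 b).trace_mul_nonneg (hρ x ω).1)).1
        have h1 : ∑ b, (F y ω b * ρ x ω).trace.re = 1 := by
          rw [← Complex.re_sum, ← Matrix.trace_sum, ← Finset.sum_mul, (hF y ω).2, one_mul,
            (hρ x ω).2, Complex.one_re]
        rw [Real.norm_eq_abs, abs_of_nonneg (h0 b), ← h1]
        exact Finset.single_le_sum (fun b _ => h0 b) (Finset.mem_univ b)
      · simp
  · refine le_of_eq_of_le ?_ (hc (fun x => α x ω) (fun x => ρ x ω) (fun y => F y ω)
      (fun x => hρ x ω) fun y => hF y ω)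
    congr 1
    refine Finset.sum_congr rfl fun x _ => Finset.sum_congr rfl fun y _ => ?_
    congr 1
    simp only [correlation, sum_units_int, signVal_one, signVal_neg, sub_mul, Matrix.trace_sub,
      Complex.sub_re]
    rcases Int.units_eq_one_or (α x ω) with h | h <;> simp [h] <;> ring

end Values

/-! ### Hilbert–Schmidt operators -/

section HilbertSchmidt

variable {K : Type*} [NormedAddCommGroup K] [InnerProductSpace ℂ K] {ι : Type*}

theorem HilbertBasis.hasSum_norm_inner_sq (b : HilbertBasis ι ℂ K) (x : K) :
    HasSum (fun i => ‖inner ℂ (b i) x‖ ^ 2) (‖x‖ ^ 2) := by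
  have h := b.hasSum_inner_mul_inner x x
  have h2 := Complex.hasSum_re h
  rw [inner_self_eq_norm_sq_to_K] at h2
  have h3 : ∀ i, (inner ℂ x (b i) * inner ℂ (b i) x).re = ‖inner ℂ (b i) x‖ ^ 2 := by
    intro i
    rw [← inner_conj_symm x (b i), ← Complex.normSq_eq_conj_mul_self, Complex.ofReal_re,
      Complex.normSq_eq_norm_sq]
  simp_rw [h3] at h2
  convert h2 using 1
  norm_cast

/-- Cyclicity of the trace for products of two Hilbert–Schmidt operators. -/
theorem tsum_inner_comp_comm [CompleteSpace K] (b : HilbertBasis ι ℂ K) (S R : K →L[ℂ] K)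
    (hR : ∀ x y, inner ℂ (R x) y = inner ℂ x (R y))
    (hSs : Summable fun i => ‖S (b i)‖ ^ 2) (hRs : Summable fun i => ‖R (b i)‖ ^ 2) :
    ∑' i, inner ℂ (b i) (S (R (b i))) = ∑' i, inner ℂ (R (b i)) (S (b i)) := by
  -- Both traces are iterated sums of this double array, in opposite orders. It is absolutely
  -- summable because each of its factors is square summable.
  let f : ι → ι → ℂ := fun j i => inner ℂ (R (b j)) (b i) * inner ℂ (b i) (S (b j))
  have hsum : ∀ T : K →L[ℂ] K, Summable (fun i => ‖T (b i)‖ ^ 2) →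
      Summable fun p : ι × ι => ‖inner ℂ (b p.2) (T (b p.1))‖ ^ 2 := by
    intro T hT
    rw [summable_prod_of_nonneg fun _ => by positivity]
    refine ⟨fun j => (b.hasSum_norm_inner_sq (T (b j))).summable, ?_⟩
    simpa only [(b.hasSum_norm_inner_sq _).tsum_eq] using hT
  have hf : Summable (Function.uncurry f) := by
    refine Summable.of_norm_bounded ((hsum S hSs).add (hsum R hRs)) ?_
    rintro ⟨j, i⟩
    simp only [Function.uncurry, f, norm_mul]
    rw [norm_inner_symm (R (b j)) (b i)]
    nlinarith [sq_nonneg (‖inner ℂ (b i) (R (b j))‖ - ‖inner ℂ (b i) (S (b j))‖),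
      sq_nonneg (‖inner ℂ (b i) (R (b j))‖), sq_nonneg (‖inner ℂ (b i) (S (b j))‖)]
  have h1 : ∀ i, inner ℂ (b i) (S (R (b i))) = ∑' j, f j i := by
    intro i
    rw [← ContinuousLinearMap.adjoint_inner_left, ← b.tsum_inner_mul_inner]
    refine tsum_congr fun j => ?_
    rw [ContinuousLinearMap.adjoint_inner_left, ← hR, mul_comm]
  have h2 : ∀ j, inner ℂ (R (b j)) (S (b j)) = ∑' i, f j i := fun j =>
    (b.tsum_inner_mul_inner _ _).symm
  simp_rw [h1, h2]
  exact Summable.tsum_comm hf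

theorem opTrace_eq_tsum (K : Type) [NormedAddCommGroup K] [InnerProductSpace ℂ K]
    [CompleteSpace K] : ∃ (ι : Type) (b : HilbertBasis ι ℂ K),
      ∀ T : K →L[ℂ] K, opTrace T = ∑' i, inner ℂ (b i) (T (b i)) :=
  ⟨_, (exists_hilbertBasis ℂ K).choose_spec.choose, fun _ => rfl⟩

theorem ContinuousLinearMap.IsPositive.exists_sqrt {K : Type*} [NormedAddCommGroup K]
    [InnerProductSpace ℂ K] [CompleteSpace K] {ρ : K →L[ℂ] K} (hρ : ρ.IsPositive) :
    ∃ R : K →L[ℂ] K, R.IsPositive ∧ R * R = ρ :=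
  ⟨CFC.sqrt ρ, (ContinuousLinearMap.nonneg_iff_isPositive _).1 (CFC.sqrt_nonneg ρ),
    CFC.sqrt_mul_sqrt_self ρ ((ContinuousLinearMap.nonneg_iff_isPositive ρ).2 hρ)⟩

/-- A density operator `ρ` represents operators by vectors `V T` of a Hilbert space, namely the
Hilbert–Schmidt operators `T ρ^{1/2}`, so that inner products are expectations. -/
theorem IsDensityOperator.exists_inner_eq_opTrace {K : Type} [NormedAddCommGroup K]
    [InnerProductSpace ℂ K] [CompleteSpace K] {ρ : K →L[ℂ] K} (h : IsDensityOperator ρ) :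
    ∃ (L : Type) (_ : NormedAddCommGroup L) (_ : InnerProductSpace ℂ L) (_ : CompleteSpace L)
      (V : (K →L[ℂ] K) → L), (∀ S T, V (S - T) = V S - V T) ∧
      (∀ T : K →L[ℂ] K, (∀ x, ‖T x‖ ≤ ‖x‖) → ‖V T‖ ≤ 1) ∧
      ∀ S T : K →L[ℂ] K, (∀ x y, inner ℂ (S x) y = inner ℂ x (S y)) →
        opTrace ((S * T).comp ρ) = inner ℂ (V S) (V T) := by
  obtain ⟨hρ, htr⟩ := h
  obtain ⟨ι, b, hb⟩ := opTrace_eq_tsum K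
  obtain ⟨R, hRpos, hRR⟩ := hρ.exists_sqrt
  have hR : ∀ x y, inner ℂ (R x) y = inner ℂ x (R y) := hRpos.inner_left_eq_inner_right
  have hρb : ∀ i, inner ℂ (b i) (ρ (b i)) = ((‖R (b i)‖ ^ 2 : ℝ) : ℂ) := by
    intro i
    rw [← hRR, mul_apply_eq_comp, ← hR, inner_self_eq_norm_sq_to_K]
    norm_cast
  have htr' : ∑' i, ((‖R (b i)‖ ^ 2 : ℝ) : ℂ) = 1 := by
    rw [← htr, hb]
    exact tsum_congr fun i => (hρb i).symm
  have hsumC : Summable fun i => ((‖R (b i)‖ ^ 2 : ℝ) : ℂ) := by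
    -- A non-summable family has `tsum` equal to `0`, which contradicts trace one.
    by_contra h
    rw [tsum_eq_zero_of_not_summable h] at htr'
    exact zero_ne_one htr'
  have hsum : Summable fun i => ‖R (b i)‖ ^ 2 := by exact_mod_cast hsumC
  have hone : ∑' i, ‖R (b i)‖ ^ 2 = 1 := by exact_mod_cast htr'
  have hsumT : ∀ T : K →L[ℂ] K, Summable fun i => ‖T (R (b i))‖ ^ 2 := by
    intro T
    refine Summable.of_nonneg_of_le (fun i => by positivity) (fun i => ?_) (hsum.mul_left (‖T‖ ^ 2))
    rw [← mul_pow]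
    exact pow_le_pow_left₀ (norm_nonneg _) (T.le_opNorm _) 2
  have hVex : ∀ T : K →L[ℂ] K, ∃ v : lp (fun _ : ι => K) 2, ∀ i, v i = T (R (b i)) := fun T =>
    ⟨⟨fun i => T (R (b i)), memℓp_gen (by simpa using hsumT T)⟩, fun _ => rfl⟩
  choose V hV using hVex
  refine ⟨lp (fun _ : ι => K) 2, inferInstance, inferInstance, inferInstance, V, fun S T => ?_,
    fun T hT => ?_, fun S T hS => ?_⟩
  · ext i
    rw [lp.coeFn_sub, Pi.sub_apply, hV, hV, hV, sub_apply]
  · have h := lp.norm_rpow_eq_tsum (p := 2) (by simp) (V T)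
    simp only [ENNReal.toReal_ofNat, Real.rpow_ofNat, hV] at h
    rw [← sq_le_one_iff₀ (norm_nonneg _), h, ← hone]
    exact Summable.tsum_le_tsum (fun i => pow_le_pow_left₀ (norm_nonneg _) (hT _) 2) (hsumT T) hsum
  · have hsumST : Summable fun i => ‖((S * T).comp R) (b i)‖ ^ 2 := hsumT (S * T)
    rw [lp.inner_eq_tsum, hb, ← hRR]
    -- With `ρ = R R`, cyclicity moves one factor `R` to the front, after which the self-adjoint `S`
    -- crosses the inner product.
    calc _ = ∑' i, inner ℂ (b i) (((S * T).comp R) (R (b i))) := tsum_congr fun i => by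
          simp only [ContinuousLinearMap.comp_apply, mul_apply_eq_comp]
      _ = ∑' i, inner ℂ (R (b i)) (((S * T).comp R) (b i)) :=
          tsum_inner_comp_comm b _ R hR hsumST hsum
      _ = _ := tsum_congr fun i => by
          rw [hV, hV, hS, ContinuousLinearMap.comp_apply, mul_apply_eq_comp]

end HilbertSchmidt

/-! ### Operators on the Hilbert space tensor product -/

section TensorOp

variable {H₁ H₂ : Type} [NormedAddCommGroup H₁] [InnerProductSpace ℂ H₁]
    [NormedAddCommGroup H₂] [InnerProductSpace ℂ H₂]

theorem tensorOp_coe (A : H₁ →L[ℂ] H₁) (B : H₂ →L[ℂ] H₂) (x : H₁ ⊗[ℂ] H₂) :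
    tensorOp A B (x : HilbertTensor H₁ H₂) = (TensorProduct.mapL A B x : HilbertTensor H₁ H₂) :=
  ContinuousLinearMap.extend_eq
    ((UniformSpace.Completion.toComplL (𝕜 := ℂ) (E := H₁ ⊗[ℂ] H₂)).comp
      (TensorProduct.mapL A B)) (e := UniformSpace.Completion.toComplL)
    UniformSpace.Completion.denseRange_coe
    (UniformSpace.Completion.isUniformInducing_coe _) x

theorem tensorOp_mul (A A' : H₁ →L[ℂ] H₁) (B B' : H₂ →L[ℂ] H₂) :
    tensorOp (A * A') (B * B') = tensorOp A B * tensorOp A' B' := by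
  ext x
  induction x using UniformSpace.Completion.induction_on with
  | hp => exact isClosed_eq (by fun_prop) (by fun_prop)
  | ih x => simp only [mul_apply_eq_comp, tensorOp_coe, TensorProduct.mapL_mul]

theorem tensorOp_one : tensorOp (1 : H₁ →L[ℂ] H₁) (1 : H₂ →L[ℂ] H₂) = 1 := by
  ext x
  induction x using UniformSpace.Completion.induction_on with
  | hp => exact isClosed_eq (by fun_prop) (by fun_prop)
  | ih x =>
    rw [tensorOp_coe]
    exact congrArg _ (congrArg (fun f : H₁ ⊗[ℂ] H₂ →L[ℂ] H₁ ⊗[ℂ] H₂ => f x)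
      TensorProduct.mapL_id_id)

theorem tensorOp_sub_left (A A' : H₁ →L[ℂ] H₁) (B : H₂ →L[ℂ] H₂) :
    tensorOp (A - A') B = tensorOp A B - tensorOp A' B := by
  rw [eq_sub_iff_add_eq]
  ext x
  induction x using UniformSpace.Completion.induction_on with
  | hp => exact isClosed_eq (by fun_prop) (by fun_prop)
  | ih x =>
    rw [add_apply, tensorOp_coe, tensorOp_coe, tensorOp_coe,
      ← UniformSpace.Completion.coe_add, ← add_apply,
      ← TensorProduct.mapL_add_left, sub_add_cancel]

theorem tensorOp_sub_right (A : H₁ →L[ℂ] H₁) (B B' : H₂ →L[ℂ] H₂) :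
    tensorOp A (B - B') = tensorOp A B - tensorOp A B' := by
  rw [eq_sub_iff_add_eq]
  ext x
  induction x using UniformSpace.Completion.induction_on with
  | hp => exact isClosed_eq (by fun_prop) (by fun_prop)
  | ih x =>
    rw [add_apply, tensorOp_coe, tensorOp_coe, tensorOp_coe,
      ← UniformSpace.Completion.coe_add, ← add_apply,
      ← TensorProduct.mapL_add_right, sub_add_cancel]

theorem norm_tensorOp_apply_le {A : H₁ →L[ℂ] H₁} {B : H₂ →L[ℂ] H₂} (hA : ‖A‖ ≤ 1) (hB : ‖B‖ ≤ 1)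
    (x : HilbertTensor H₁ H₂) : ‖tensorOp A B x‖ ≤ ‖x‖ := by
  induction x using UniformSpace.Completion.induction_on with
  | hp => exact isClosed_le (by fun_prop) (by fun_prop)
  | ih x =>
    rw [tensorOp_coe, UniformSpace.Completion.norm_coe, UniformSpace.Completion.norm_coe]
    refine (TensorProduct.mapL A B).le_of_opNorm_le
      ((TensorProduct.norm_mapL_le A B).trans (mul_le_one₀ hA (norm_nonneg _) hB)) x |>.trans ?_
    rw [one_mul]

theorem inner_tensorOp_left {A : H₁ →L[ℂ] H₁} {B : H₂ →L[ℂ] H₂}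
    (hA : ∀ x y, inner ℂ (A x) y = inner ℂ x (A y)) (hB : ∀ x y, inner ℂ (B x) y = inner ℂ x (B y))
    (x y : HilbertTensor H₁ H₂) : inner ℂ (tensorOp A B x) y = inner ℂ x (tensorOp A B y) := by
  induction x, y using UniformSpace.Completion.induction_on₂ with
  | hp => exact isClosed_eq (by fun_prop) (by fun_prop)
  | ih x y =>
    rw [tensorOp_coe, tensorOp_coe, UniformSpace.Completion.inner_coe,
      UniformSpace.Completion.inner_coe]
    induction x with
    | zero => simp
    | add x x' hx hx' => rw [map_add, inner_add_left, inner_add_left, hx, hx']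
    | tmul x x' =>
      induction y with
      | zero => simp
      | add y y' hy hy' => rw [map_add, inner_add_right, inner_add_right, hy, hy']
      | tmul y y' => simp [TensorProduct.inner_tmul, hA, hB]

end TensorOp

/-! ### The quantum value is controlled by the Grothendieck constant -/

section POVM

variable {H : Type*} [NormedAddCommGroup H] [InnerProductSpace ℂ H] [CompleteSpace H]

/-- With `y = E 1 x` and `z = E (-1) x`, the real part of `⟨y, z⟩` equals that of `⟨E 1 z, z⟩ + ⟨E
(-1) y, y⟩`, hence is nonnegative. Therefore `‖y - z‖ ≤ ‖y + z‖ = ‖x‖`. -/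
theorem IsPOVM.norm_sub_le_one {E : ℤˣ → (H →L[ℂ] H)} (hE : IsPOVM E) : ‖E 1 - E (-1)‖ ≤ 1 := by
  obtain ⟨hpos, hsum⟩ := hE
  rw [sum_units_int] at hsum
  refine ContinuousLinearMap.opNorm_le_bound _ zero_le_one fun x => ?_
  rw [one_mul]
  set y := E 1 x with hy
  set z := E (-1) x with hz
  have hx : x = y + z := by
    rw [hy, hz, ← add_apply, hsum, one_apply_eq_self]
  have h1 := (hpos 1).re_inner_nonneg_left (x - y)
  have h2 := (hpos (-1)).re_inner_nonneg_left y
  have h3 : E (-1) y = y - E 1 y := by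
    rw [eq_sub_iff_add_eq', ← add_apply, hsum, one_apply_eq_self]
  have h4 : inner ℂ (E 1 y) x = inner ℂ y y := (hpos 1).inner_left_eq_inner_right y x
  rw [h3] at h2
  simp only [map_sub, inner_sub_left, inner_sub_right, ← hy, h4] at h1 h2
  have h5 : (0 : ℝ) ≤ RCLike.re (inner ℂ y z) := by
    rw [show z = x - y by rw [hx]; abel, inner_sub_right, map_sub]
    linarith
  refine le_of_sq_le_sq ?_ (norm_nonneg _)
  rw [sub_apply, ← hy, ← hz, hx, @norm_sub_sq ℂ, @norm_add_sq ℂ]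
  linarith

end POVM

section QuantumValue

variable {X : Type u} {Y : Type v} [Fintype X] [Fintype Y] {G : XORGame X Y}

/-- Quantum correlations are inner products of vectors in the unit ball of a real Hilbert space. -/
theorem IsQuantum.exists_correlation_eq_inner {X : Type u} {Y : Type v} {P : Behaviour X Y}
    (hP : IsQuantum P) :
    ∃ (L : Type) (_ : NormedAddCommGroup L) (_ : InnerProductSpace ℝ L) (_ : CompleteSpace L)
      (w : X → L) (z : Y → L), (∀ x, ‖w x‖ ≤ 1) ∧ (∀ y, ‖z y‖ ≤ 1) ∧
      ∀ x y, correlation P x y = inner ℝ (w x) (z y) := by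
  obtain ⟨H₁, H₂, _, _, _, _, _, _, ρ, E, F, hρ, hE, hF, hP⟩ := hP
  obtain ⟨L, _, _, _, V, hVsub, hVnorm, hV⟩ := hρ.exists_inner_eq_opTrace
  refine ⟨L, inferInstance, InnerProductSpace.complexToReal, inferInstance,
    fun x => V (tensorOp (E x 1 - E x (-1)) 1), fun y => V (tensorOp 1 (F y 1 - F y (-1))),
    fun x => hVnorm _ (norm_tensorOp_apply_le (hE x).norm_sub_le_one ContinuousLinearMap.norm_id_le),
    fun y => hVnorm _ (norm_tensorOp_apply_le ContinuousLinearMap.norm_id_le (hF y).norm_sub_le_one),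
    fun x y => ?_⟩
  have hre : ∀ a c, P a c x y =
      (inner ℂ (V (tensorOp (E x a) 1)) (V (tensorOp 1 (F y c)))).re := by
    intro a c
    rw [← hV _ _ (inner_tensorOp_left ((hE x).1 a).inner_left_eq_inner_right fun _ _ => rfl),
      ← tensorOp_mul, mul_one, one_mul, ← hP, Complex.ofReal_re]
  dsimp only
  rw [real_inner_eq_re_inner ℂ, tensorOp_sub_left, tensorOp_sub_right, hVsub, hVsub]
  simp only [inner_sub_left, inner_sub_right, correlation, sum_units_int, hre, signVal_one,
    signVal_neg, map_sub, RCLike.re_to_complex]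
  ring

theorem abs_bellPairing_le_of_isQuantum {P : Behaviour X Y} (hP : IsQuantum P) :
    |bellPairing G.functional P| ≤ realGrothendieckConstant * G.classicalValue := by
  obtain ⟨L, _, _, _, w, z, hw, hz, h⟩ := hP.exists_correlation_eq_inner
  rw [bellPairing_functional]
  simp_rw [h]
  exact abs_sum_inner_le_realGrothendieckConstant (classicalValue_pos G)
    abs_sum_coeff_signVal_le_classicalValue hw hz

theorem quantumValue_le : G.quantumValue ≤ realGrothendieckConstant * G.classicalValue :=
  bellValue_le (mul_nonneg realGrothendieckConstant_nonneg (classicalValue_pos G).le)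
    fun _ hP => abs_bellPairing_le_of_isQuantum hP

end QuantumValue

/-! ### Real Clifford matrices -/

section Clifford

/-- Doubling the size adds one generator: the off-diagonal blocks `w 0` anticommute with the
diagonal blocks `A, -A`, so the cross terms cancel in the square. -/
theorem exists_clifford_fin (d : ℕ) : ∃ (ι : Type) (_ : Fintype ι) (_ : DecidableEq ι)
    (_ : Nonempty ι) (A : (Fin d → ℝ) → Matrix ι ι ℝ),
    (∀ w, (A w).transpose = A w) ∧ (∀ w z, A (w + z) = A w + A z) ∧
    ∀ w, A w * A w = (∑ k, w k ^ 2) • (1 : Matrix ι ι ℝ) := by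
  induction d with
  | zero => exact ⟨Unit, inferInstance, inferInstance, inferInstance, fun _ => 0, by simp⟩
  | succ d ih =>
    obtain ⟨ι, _, _, _, A, hsymm, hadd, hsq⟩ := ih
    refine ⟨ι ⊕ ι, inferInstance, inferInstance, inferInstance, fun w =>
      Matrix.fromBlocks (A (Fin.tail w)) (w 0 • 1) (w 0 • 1) (-A (Fin.tail w)), ?_, ?_, ?_⟩
    · intro w
      simp [Matrix.fromBlocks_transpose, hsymm]
    · intro w z
      rw [Matrix.fromBlocks_add, ← add_smul, ← neg_add, ← hadd]
      rfl
    · intro w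
      rw [Matrix.fromBlocks_multiply, ← Matrix.fromBlocks_one, Matrix.fromBlocks_smul,
        Fin.sum_univ_succ]
      simp only [neg_mul, mul_neg, neg_neg, hsq, Matrix.smul_mul, Matrix.mul_smul, one_mul, mul_one,
        add_neg_cancel, smul_smul, ← add_smul, smul_zero, Fin.tail]
      rw [add_comm (∑ k : Fin d, w k.succ ^ 2), ← sq]

/-- Real Clifford matrices: symmetric matrices depending additively on a vector, with square the
squared length. -/
theorem exists_clifford (κ : Type*) [Fintype κ] : ∃ (ι : Type) (_ : Fintype ι) (_ : DecidableEq ι)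
    (_ : Nonempty ι) (A : (κ → ℝ) → Matrix ι ι ℝ), (∀ w, (A w).transpose = A w) ∧
    (∀ w, A w * A w = (∑ k, w k ^ 2) • (1 : Matrix ι ι ℝ)) ∧
    ∀ w z, (A w * A z).trace = Fintype.card ι * ∑ k, w k * z k := by
  obtain ⟨ι, i₁, i₂, i₃, A, hsymm, hadd, hsq⟩ := exists_clifford_fin (Fintype.card κ)
  let e := Fintype.equivFin κ
  have hsq' : ∀ w : κ → ℝ, A (w ∘ e.symm) * A (w ∘ e.symm) =
      (∑ k, w k ^ 2) • (1 : Matrix ι ι ℝ) := by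
    intro w
    rw [hsq]
    congr 1
    exact Equiv.sum_comp e.symm fun k => w k ^ 2
  refine ⟨ι, i₁, i₂, i₃, fun w => A (w ∘ e.symm), fun w => hsymm _, hsq', fun w z => ?_⟩
  -- Polarization: the squares at `w + z`, `w` and `z`, together with cyclicity of the trace,
  -- determine the trace of the product.
  have h := hsq' (w + z)
  rw [show (w + z) ∘ e.symm = w ∘ e.symm + z ∘ e.symm from rfl, hadd, add_mul, mul_add, mul_add,
    hsq', hsq'] at h
  have h2 := congrArg Matrix.trace h
  simp only [Matrix.trace_add, Matrix.trace_smul, Matrix.trace_one, smul_eq_mul] at h2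
  rw [Matrix.trace_mul_comm (A (z ∘ e.symm))] at h2
  have h3 : ∑ k, (w + z) k ^ 2 = ∑ k, w k ^ 2 + 2 * ∑ k, w k * z k + ∑ k, z k ^ 2 := by
    rw [Finset.mul_sum, ← Finset.sum_add_distrib, ← Finset.sum_add_distrib]
    exact Finset.sum_congr rfl fun k _ => by simp only [Pi.add_apply]; ring
  rw [h3] at h2
  linarith

end Clifford

/-! ### Quantum strategies from real matrices -/

section MaximallyEntangled

theorem Matrix.PosSemidef.map_ofReal {ι : Type*} [Fintype ι] {M : Matrix ι ι ℝ}
    (hM : M.PosSemidef) : (M.map Complex.ofReal).PosSemidef := by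
  obtain ⟨C, rfl⟩ := hM.exists_eq_conjTranspose_mul_self
  have h : (C.conjTranspose * C).map Complex.ofReal =
      (C.map Complex.ofReal).conjTranspose * C.map Complex.ofReal := by
    ext i j
    simp [Matrix.mul_apply]
  rw [h]
  exact Matrix.posSemidef_conjTranspose_mul_self _

theorem Matrix.PosSemidef.isPositive_toEuclideanCLM {ι : Type*} [Fintype ι] [DecidableEq ι]
    {M : Matrix ι ι ℂ} (hM : M.PosSemidef) :
    (Matrix.toEuclideanCLM (n := ι) (𝕜 := ℂ) M).IsPositive := by
  obtain ⟨C, rfl⟩ := hM.exists_eq_conjTranspose_mul_self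
  rw [← Matrix.star_eq_conjTranspose, map_mul, map_star]
  exact ContinuousLinearMap.isPositive_adjoint_comp_self _

theorem opTrace_comp_rankOne {K : Type} [NormedAddCommGroup K] [InnerProductSpace ℂ K]
    [CompleteSpace K] (T : K →L[ℂ] K) (φ : K) :
    opTrace (T.comp (InnerProductSpace.rankOne ℂ φ φ)) = inner ℂ φ (T φ) := by
  obtain ⟨ι, b, hb⟩ := opTrace_eq_tsum K
  rw [hb, ← b.tsum_inner_mul_inner]
  refine tsum_congr fun i => ?_
  simp

theorem isDensityOperator_rankOne {K : Type} [NormedAddCommGroup K] [InnerProductSpace ℂ K]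
    [CompleteSpace K] {φ : K} (hφ : inner ℂ φ φ = (1 : ℂ)) :
    IsDensityOperator (InnerProductSpace.rankOne ℂ φ φ) := by
  refine ⟨InnerProductSpace.isPositive_rankOne_self φ, ?_⟩
  have h := opTrace_comp_rankOne (ContinuousLinearMap.id ℂ K) φ
  rw [ContinuousLinearMap.id_comp] at h
  rw [h, ContinuousLinearMap.id_apply, hφ]

variable {ι : Type} [Fintype ι] [DecidableEq ι]

/-- The unnormalized maximally entangled vector. -/
noncomputable def entangledVector (ι : Type) [Fintype ι] [DecidableEq ι] :
    HilbertTensor (EuclideanSpace ℂ ι) (EuclideanSpace ℂ ι) :=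
  ((∑ i : ι, EuclideanSpace.single i (1 : ℂ) ⊗ₜ[ℂ] EuclideanSpace.single i (1 : ℂ) :
    EuclideanSpace ℂ ι ⊗[ℂ] EuclideanSpace ℂ ι) :
    HilbertTensor (EuclideanSpace ℂ ι) (EuclideanSpace ℂ ι))

/-- The right side is the trace of `M Nᵀ`. As the Clifford matrices are symmetric, entangled
expectations become traces of products. -/
theorem inner_entangledVector (M N : Matrix ι ι ℂ) :
    inner ℂ (entangledVector ι) (tensorOp (Matrix.toEuclideanCLM (n := ι) (𝕜 := ℂ) M)
      (Matrix.toEuclideanCLM (n := ι) (𝕜 := ℂ) N) (entangledVector ι)) =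
      ∑ i, ∑ j, M i j * N i j := by
  rw [entangledVector, tensorOp_coe, UniformSpace.Completion.inner_coe, map_sum, sum_inner]
  simp_rw [inner_sum, TensorProduct.mapL_tmul, TensorProduct.inner_tmul]
  simp [EuclideanSpace.inner_single_left, Matrix.mulVec_single]

end MaximallyEntangled

/-! ### Tsirelson's construction of entangled correlations. -/

section Tsirelson

variable {X : Type u} {Y : Type v}

/-- Inner products of vectors in the Euclidean unit ball are quantum correlations. -/
theorem exists_isQuantum_correlation_eq {κ : Type*} [Fintype κ] {w : X → κ → ℝ} {z : Y → κ → ℝ}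
    (hw : ∀ x, ∑ k, w x k ^ 2 ≤ 1) (hz : ∀ y, ∑ k, z y k ^ 2 ≤ 1) :
    ∃ P : Behaviour X Y, IsQuantum P ∧ ∀ x y, correlation P x y = ∑ k, w x k * z y k := by
  obtain ⟨ι, _, _, _, A, hsymm, hsq, htr⟩ := exists_clifford κ
  have hN : (0 : ℝ) < Fintype.card ι := by exact_mod_cast Fintype.card_pos
  let E : (κ → ℝ) → ℤˣ → Matrix ι ι ℝ := fun w a => (1 / 2 : ℝ) • (1 + signVal a • A w)
  have hE : ∀ w a, ∑ k, w k ^ 2 ≤ 1 → (E w a).PosSemidef := by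
    intro w a h
    -- Since `A w` squares to `|w|²`, one has `2 (1 + s A) = (1 + s A)² + (1 - |w|²)` for a sign
    -- `s`. The last term is where vectors strictly inside the ball are allowed.
    have h1 : E w a = (1 / 4 : ℝ) • ((1 + signVal a • A w).conjTranspose * (1 + signVal a • A w) +
        (1 - ∑ k, w k ^ 2) • (1 : Matrix ι ι ℝ)) := by
      have h2 : (1 + signVal a • A w).conjTranspose = 1 + signVal a • A w := by
        simp [Matrix.conjTranspose_eq_transpose_of_trivial, hsymm]
      have h3 : signVal a • A w * signVal a • A w = (∑ k, w k ^ 2) • (1 : Matrix ι ι ℝ) := by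
        rw [Matrix.smul_mul, Matrix.mul_smul, smul_smul, signVal_mul_self, one_smul, hsq]
      rw [h2, add_mul, mul_add, mul_add, h3]
      simp only [E, one_mul, mul_one]
      module
    rw [h1]
    refine Matrix.PosSemidef.smul (Matrix.PosSemidef.add
      (Matrix.posSemidef_conjTranspose_mul_self _) (Matrix.PosSemidef.one.smul ?_)) (by norm_num)
    linarith
  let O : (κ → ℝ) → ℤˣ → (EuclideanSpace ℂ ι →L[ℂ] EuclideanSpace ℂ ι) := fun w a =>
    Matrix.toEuclideanCLM (n := ι) (𝕜 := ℂ) ((E w a).map Complex.ofReal)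
  have hO : ∀ w, ∑ k, w k ^ 2 ≤ 1 → IsPOVM (O w) := by
    intro w h
    refine ⟨fun a => (hE w a h).map_ofReal.isPositive_toEuclideanCLM, ?_⟩
    rw [← map_sum]
    have h1 : ∑ a, (E w a).map Complex.ofReal = 1 := by
      rw [sum_units_int]
      ext i j
      by_cases hij : i = j
      · subst hij
        simp [E]
        ring
      · simp [E, Matrix.one_apply_ne hij]
    rw [h1, map_one]
  have hinner : ∀ M N : Matrix ι ι ℝ,
      inner ℂ (((√(Fintype.card ι : ℝ))⁻¹ : ℂ) • entangledVector ι)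
        (tensorOp (Matrix.toEuclideanCLM (n := ι) (𝕜 := ℂ) (M.map Complex.ofReal))
          (Matrix.toEuclideanCLM (n := ι) (𝕜 := ℂ) (N.map Complex.ofReal))
          (((√(Fintype.card ι : ℝ))⁻¹ : ℂ) • entangledVector ι)) =
        (((∑ i, ∑ j, M i j * N i j) / Fintype.card ι : ℝ) : ℂ) := by
    intro M N
    rw [map_smul, inner_smul_left, inner_smul_right, inner_entangledVector, ← mul_assoc]
    have h : (starRingEnd ℂ) ((√(Fintype.card ι : ℝ))⁻¹ : ℂ) * ((√(Fintype.card ι : ℝ))⁻¹ : ℂ) =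
        (((Fintype.card ι : ℝ)⁻¹ : ℝ) : ℂ) := by
      rw [← Complex.ofReal_inv, Complex.conj_ofReal, ← Complex.ofReal_mul, ← mul_inv,
        Real.mul_self_sqrt hN.le]
    rw [h]
    push_cast
    simp only [Matrix.map_apply]
    ring
  have hφ : inner ℂ (((√(Fintype.card ι : ℝ))⁻¹ : ℂ) • entangledVector ι)
      (((√(Fintype.card ι : ℝ))⁻¹ : ℂ) • entangledVector ι) = (1 : ℂ) := by
    have h := hinner 1 1
    rw [Matrix.map_one _ Complex.ofReal_zero Complex.ofReal_one, map_one, tensorOp_one,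
      one_apply_eq_self] at h
    rw [h]
    simp [Matrix.one_apply, hN.ne']
  refine ⟨fun a b x y => (∑ i, ∑ j, E (w x) a i j * E (z y) b i j) / Fintype.card ι,
    ⟨EuclideanSpace ℂ ι, EuclideanSpace ℂ ι, inferInstance, inferInstance, inferInstance,
      inferInstance, inferInstance, inferInstance, _, fun x => O (w x), fun y => O (z y),
      isDensityOperator_rankOne hφ, fun x => hO _ (hw x), fun y => hO _ (hz y), fun a b x y => ?_⟩,
    fun x y => ?_⟩
  · rw [opTrace_comp_rankOne]
    exact (hinner _ _).symm
  · have h := htr (w x) (z y)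
    rw [eq_comm, mul_comm, ← eq_div_iff hN.ne'] at h
    rw [h]
    simp only [correlation, sum_units_int, E, Matrix.trace, Matrix.diag, Matrix.mul_apply]
    have h2 : ∀ i j, A (z y) j i = A (z y) i j := fun i j => by
      conv_lhs => rw [← hsymm, Matrix.transpose_apply]
    simp only [h2, signVal_one, signVal_neg, mul_div_assoc', ← add_div, Finset.mul_sum,
      ← Finset.sum_add_distrib]
    congr 1
    refine Finset.sum_congr rfl fun i _ => Finset.sum_congr rfl fun j _ => ?_
    simp only [Matrix.smul_apply, Matrix.add_apply, smul_eq_mul]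
    ring

end Tsirelson

/-! ### One-way quantum communication versus entanglement -/

section OneWayQuantum

variable {X : Type u} {Y : Type v} [Fintype X] [Fintype Y] {G : XORGame X Y}

theorem Matrix.IsHermitian.trace_mul_re {ι : Type*} [Fintype ι] {M : Matrix ι ι ℂ}
    (hM : M.IsHermitian) (N : Matrix ι ι ℂ) : (M * N).trace.re =
      ∑ i, ∑ j, ((M i j).re * (N i j).re + (M i j).im * (N i j).im) := by
  rw [Finset.sum_comm]
  simp only [Matrix.trace, Matrix.diag, Matrix.mul_apply, Complex.re_sum]
  refine Finset.sum_congr rfl fun i _ => Finset.sum_congr rfl fun j _ => ?_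
  rw [← hM.apply i j]
  simp

/-- Cauchy–Schwarz for the columns of a factor `C` with `M = C* C`. -/
theorem Matrix.PosSemidef.norm_apply_sq_le {ι : Type*} [Fintype ι] {M : Matrix ι ι ℂ}
    (hM : M.PosSemidef) (i j : ι) : ‖M i j‖ ^ 2 ≤ (M i i).re * (M j j).re := by
  obtain ⟨C, rfl⟩ := hM.exists_eq_conjTranspose_mul_self
  have hd : ∀ i, ((C.conjTranspose * C) i i).re = ∑ k, ‖C k i‖ ^ 2 := by
    intro i
    simp only [Matrix.mul_apply, Matrix.conjTranspose_apply, Complex.re_sum]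
    refine Finset.sum_congr rfl fun k _ => ?_
    rw [Complex.star_def, ← Complex.normSq_eq_conj_mul_self, Complex.ofReal_re,
      Complex.normSq_eq_norm_sq]
  rw [hd, hd]
  refine le_trans ?_ (Finset.sum_mul_sq_le_sq_mul_sq _ _ _)
  refine pow_le_pow_left₀ (norm_nonneg _) ?_ 2
  rw [Matrix.mul_apply]
  refine (norm_sum_le _ _).trans (Finset.sum_le_sum fun k _ => ?_)
  rw [norm_mul, Matrix.conjTranspose_apply, norm_star]

theorem Matrix.PosSemidef.sum_norm_sq_le {ι : Type*} [Fintype ι] {M : Matrix ι ι ℂ}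
    (hM : M.PosSemidef) : ∑ i, ∑ j, ‖M i j‖ ^ 2 ≤ M.trace.re ^ 2 := by
  rw [sq, Matrix.trace, Complex.re_sum, Finset.sum_mul_sum]
  exact Finset.sum_le_sum fun i _ => Finset.sum_le_sum fun j _ => hM.norm_apply_sq_le i j

/-- The difference squares to `1 - 2 (M N + N M)`, and the trace of `M N` is nonnegative. This
dimension bound is the source of the factor `√n` in the converse. -/
theorem sum_norm_sq_sub_le {ι : Type*} [Fintype ι] [DecidableEq ι] {M N : Matrix ι ι ℂ}
    (hM : M.PosSemidef) (hN : N.PosSemidef) (h : M + N = 1) :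
    ∑ i, ∑ j, ‖(M - N) i j‖ ^ 2 ≤ Fintype.card ι := by
  have h1 := (hM.isHermitian.sub hN.isHermitian).trace_mul_re (M - N)
  have h2 : ∑ i, ∑ j, ‖(M - N) i j‖ ^ 2 = ((M - N) * (M - N)).trace.re := by
    rw [h1]
    refine Finset.sum_congr rfl fun i _ => Finset.sum_congr rfl fun j _ => ?_
    rw [← Complex.normSq_eq_norm_sq, Complex.normSq_apply]
  have h3 : (M - N) * (M - N) = 1 - (2 • (M * N) + 2 • (N * M)) := by
    rw [← one_mul (1 : Matrix ι ι ℂ), ← h]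
    noncomm_ring
  have h4 := (Complex.le_def.1 (hM.trace_mul_nonneg hN)).1
  rw [h2, h3, Matrix.trace_sub, Matrix.trace_add, Matrix.trace_smul, Matrix.trace_smul,
    Matrix.trace_mul_comm N M, Matrix.trace_one]
  simp only [Complex.zero_re] at h4
  simp
  linarith

/-- The trace pairing is the real inner product of the entries of a state and an observable, whose
Hilbert–Schmidt norms are at most `1` and `√n`. After division by `√n`, Tsirelson's construction
realizes the same correlations by entanglement. -/
theorem abs_oneWayQuantum_le_sqrt_mul_quantumValue {n : ℕ} (hn : 0 < n) (t : X → ℤˣ)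
    (ρ : X → Matrix (Fin n) (Fin n) ℂ) (F : Y → ℤˣ → Matrix (Fin n) (Fin n) ℂ)
    (hρ : ∀ x, (ρ x).PosSemidef ∧ (ρ x).trace = 1)
    (hF : ∀ y, (∀ b, (F y b).PosSemidef) ∧ ∑ b, F y b = 1) :
    |∑ x, ∑ y, G.coeff x y * (signVal (t x) * ((F y 1 - F y (-1)) * ρ x).trace.re)| ≤
      √(n : ℝ) * G.quantumValue := by
  have hn' : (0 : ℝ) < n := by exact_mod_cast hn
  have hs : 0 < √(n : ℝ) := Real.sqrt_pos.2 hn'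
  let w : X → (Fin n × Fin n) ⊕ (Fin n × Fin n) → ℝ := fun x =>
    Sum.elim (fun p => signVal (t x) * (ρ x p.1 p.2).re) fun p => signVal (t x) * (ρ x p.1 p.2).im
  let z : Y → (Fin n × Fin n) ⊕ (Fin n × Fin n) → ℝ := fun y =>
    Sum.elim (fun p => ((F y 1 - F y (-1)) p.1 p.2).re / √(n : ℝ))
      fun p => ((F y 1 - F y (-1)) p.1 p.2).im / √(n : ℝ)
  have hw : ∀ x, ∑ k, w x k ^ 2 ≤ 1 := by
    intro x
    have h := (hρ x).1.sum_norm_sq_le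
    rw [(hρ x).2] at h
    simp only [Fintype.sum_sum_type, w, Sum.elim_inl, Sum.elim_inr, Fintype.sum_prod_type, mul_pow,
      signVal_sq, one_mul, ← Finset.sum_add_distrib]
    simpa [← Complex.normSq_eq_norm_sq, Complex.normSq_apply, ← sq] using h
  have hz : ∀ y, ∑ k, z y k ^ 2 ≤ 1 := by
    intro y
    have hsum := (hF y).2
    rw [sum_units_int] at hsum
    have h := sum_norm_sq_sub_le ((hF y).1 1) ((hF y).1 (-1)) hsum
    simp only [Fintype.sum_sum_type, z, Sum.elim_inl, Sum.elim_inr, Fintype.sum_prod_type, div_pow,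
      Real.sq_sqrt hn'.le, ← Finset.sum_add_distrib, ← add_div, ← Finset.sum_div]
    rw [div_le_one hn']
    simpa [← Complex.normSq_eq_norm_sq, Complex.normSq_apply, ← sq] using h
  obtain ⟨P, hP, hcorr⟩ := exists_isQuantum_correlation_eq hw hz
  have h : |bellPairing G.functional P| ≤ G.quantumValue :=
    le_bellValue (fun P hP => abs_bellPairing_le_of_isQuantum hP) hP
  refine le_of_eq_of_le ?_ (mul_le_mul_of_nonneg_left h hs.le)
  nth_rw 1 [bellPairing_functional, ← abs_of_pos hs]
  rw [← abs_mul, Finset.mul_sum]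
  congr 1
  refine Finset.sum_congr rfl fun x _ => ?_
  rw [Finset.mul_sum]
  refine Finset.sum_congr rfl fun y _ => ?_
  rw [hcorr, (((hF y).1 1).isHermitian.sub ((hF y).1 (-1)).isHermitian).trace_mul_re]
  simp only [Fintype.sum_sum_type, w, z, Sum.elim_inl, Sum.elim_inr, Fintype.sum_prod_type,
    Finset.mul_sum, ← Finset.sum_add_distrib]
  refine Finset.sum_congr rfl fun i _ => Finset.sum_congr rfl fun j _ => ?_
  field_simp

theorem oneWayQuantumValue_le {n : ℕ} (hn : 0 < n) :
    G.oneWayQuantumValue n ≤ √(n : ℝ) * G.quantumValue :=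
  bellValue_le (mul_nonneg (Real.sqrt_nonneg _) (bellValue_nonneg _ _)) fun _ hP =>
    abs_bellPairing_le_of_isOneWayQuantum (abs_oneWayQuantum_le_sqrt_mul_quantumValue hn) hP

end OneWayQuantum

/-! ### Bilinear Rademacher forms -/

section Bilinear

/-- Jensen's inequality for `exp`, with the missing mass `1 - ∑ w` placed at `0`. -/
theorem exp_sum_le {ι : Type*} [Fintype ι] {w r : ι → ℝ} (hw : ∀ i, 0 ≤ w i)
    (hw1 : ∑ i, w i ≤ 1) :
    Real.exp (∑ i, w i * r i) ≤ (1 - ∑ i, w i) + ∑ i, w i * Real.exp (r i) := by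
  have h := convexOn_exp.map_add_sum_le (t := Finset.univ) (w := w) (p := r)
    (v := 1 - ∑ i, w i) (q := 0) (fun i _ => hw i) (by ring) (fun _ _ => Set.mem_univ _)
    (by linarith) (Set.mem_univ _)
  simpa using h

variable {ι κ : Type*} [Fintype ι] [DecidableEq ι] [Fintype κ] [DecidableEq κ]

theorem expect_prod_type {α β : Type*} [Fintype α] [Fintype β] (f : α × β → ℝ) :
    𝔼 p, f p = 𝔼 a, 𝔼 b, f (a, b) := by
  rw [← Finset.univ_product_univ, Finset.expect_product]

/-- Averaging over `x` for fixed `z` leaves the exponential of a sum of squared Rademacher sums in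
`z`, one per row. Convexity, with the squared row norms as weights, separates the rows, and each
normalized row is sub-Gaussian. -/
theorem expect_exp_bilinear_le {c : ι → κ → ℝ} (hc : ∑ i, ∑ j, c i j ^ 2 ≤ 1) :
    𝔼 w : (ι → ℤˣ) × (κ → ℤˣ),
      Real.exp ((∑ i, ∑ j, c i j * signVal (w.1 i) * signVal (w.2 j)) / 2) ≤ 2 := by
  rw [expect_prod_type, Finset.expect_comm]
  have h1 : ∀ z : κ → ℤˣ, 𝔼 x : ι → ℤˣ,
      Real.exp ((∑ i, ∑ j, c i j * signVal (x i) * signVal (z j)) / 2) ≤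
      Real.exp (∑ i, (∑ j, c i j * signVal (z j)) ^ 2 / 8) := by
    intro z
    have h := expect_exp_rademacher_le fun i => (∑ j, c i j * signVal (z j)) / 2
    have h2 : ∀ x : ι → ℤˣ, (∑ i, ∑ j, c i j * signVal (x i) * signVal (z j)) / 2 =
        ∑ i, (∑ j, c i j * signVal (z j)) / 2 * signVal (x i) := by
      intro x
      rw [Finset.sum_div]
      refine Finset.sum_congr rfl fun i _ => ?_
      rw [div_mul_eq_mul_div, Finset.sum_mul]
      congr 1
      exact Finset.sum_congr rfl fun j _ => by ring
    simp_rw [h2]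
    refine h.trans (le_of_eq ?_)
    congr 1
    rw [Finset.sum_div]
    exact Finset.sum_congr rfl fun i _ => by ring
  have h3 : ∀ i, ∃ a : κ → ℝ, ∑ j, a j ^ 2 ≤ 1 ∧ ∀ z : κ → ℤˣ,
      (∑ j, c i j * signVal (z j)) ^ 2 = (∑ j, c i j ^ 2) * (∑ j, a j * signVal (z j)) ^ 2 := by
    intro i
    have hs := Real.sq_sqrt (Finset.sum_nonneg fun j (_ : j ∈ Finset.univ) => sq_nonneg (c i j))
    rcases eq_or_ne (∑ j, c i j ^ 2) 0 with h0 | h0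
    · refine ⟨0, by simp, fun z => ?_⟩
      have : ∀ j, c i j = 0 := fun j => pow_eq_zero_iff two_ne_zero |>.1
        ((Finset.sum_eq_zero_iff_of_nonneg fun j _ => sq_nonneg (c i j)).1 h0 j (Finset.mem_univ j))
      simp [this]
    · refine ⟨fun j => c i j / √(∑ j, c i j ^ 2), ?_, fun z => ?_⟩
      · simp_rw [div_pow, ← Finset.sum_div, hs]
        exact (div_self h0).le
      · simp_rw [div_mul_eq_mul_div, ← Finset.sum_div, div_pow, hs]
        field_simp
  choose a ha hca using h3
  calc 𝔼 z : κ → ℤˣ, 𝔼 x : ι → ℤˣ,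
        Real.exp ((∑ i, ∑ j, c i j * signVal (x i) * signVal (z j)) / 2)
      ≤ 𝔼 z : κ → ℤˣ, ((1 - ∑ i, ∑ j, c i j ^ 2) +
          ∑ i, (∑ j, c i j ^ 2) * Real.exp ((∑ j, a i j * signVal (z j)) ^ 2 / 8)) := by
        refine Finset.expect_le_expect fun z _ => (h1 z).trans ?_
        simp_rw [hca, mul_div_assoc]
        exact exp_sum_le (fun i => Finset.sum_nonneg fun j _ => sq_nonneg _) hc
    _ ≤ (1 - ∑ i, ∑ j, c i j ^ 2) + ∑ i, (∑ j, c i j ^ 2) * 2 := by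
        rw [Finset.expect_add_distrib, Finset.expect_sum_comm]
        refine add_le_add (by simp) (Finset.sum_le_sum fun i _ => ?_)
        rw [← Finset.mul_expect]
        exact mul_le_mul_of_nonneg_left (expect_exp_rademacher_sq_le (a i) (ha i))
          (Finset.sum_nonneg fun j _ => sq_nonneg _)
    _ ≤ 2 := by
        rw [← Finset.sum_mul]
        linarith

/-- The maximum of `k` normalized bilinear Rademacher forms is `O(log k)` on average. -/
theorem expect_abs_bilinear_le {k : ℕ} (hk : 0 < k) {c : Fin k → ι → κ → ℝ}
    (hc : ∀ l, ∑ i, ∑ j, c l i j ^ 2 ≤ 1) (m : (ι → ℤˣ) × (κ → ℤˣ) → Fin k) :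
    𝔼 w, |∑ i, ∑ j, c (m w) i j * signVal (w.1 i) * signVal (w.2 j)| ≤
      2 * Real.log (4 * k) := by
  let h : Fin k → (ι → ℤˣ) × (κ → ℤˣ) → ℝ := fun l w =>
    ∑ i, ∑ j, c l i j * signVal (w.1 i) * signVal (w.2 j)
  have hk' : (0 : ℝ) < k := by exact_mod_cast hk
  have hexp : ∀ l, 𝔼 w, Real.exp (|h l w| / 2) ≤ 4 := by
    intro l
    calc 𝔼 w, Real.exp (|h l w| / 2) ≤ 𝔼 w, (Real.exp (h l w / 2) + Real.exp (-h l w / 2)) := by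
          refine Finset.expect_le_expect fun w _ => ?_
          rcases abs_choice (h l w) with h' | h' <;> rw [h'] <;>
            linarith [Real.exp_pos (h l w / 2), Real.exp_pos (-h l w / 2)]
      _ ≤ 2 + 2 := by
          rw [Finset.expect_add_distrib]
          refine add_le_add (expect_exp_bilinear_le (hc l)) ?_
          have h2 := expect_exp_bilinear_le (c := fun i j => -c l i j) (by simpa using hc l)
          simpa only [neg_mul, Finset.sum_neg_distrib] using h2
      _ = 4 := by norm_num
  -- The tangent bound `t ≤ exp (t - L) + L - 1` at `t = |h| / 2`, `L = log (4 k)`, with the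
  -- selected exponential replaced by the sum over all `l`. The mean of that sum is at most `4 k`,
  -- which cancels exactly the `-1`.
  have hpt : ∀ w, |h (m w) w| ≤
      2 * (Real.log (4 * k) - 1) + 1 / (2 * k) * ∑ l, Real.exp (|h l w| / 2) := by
    intro w
    have h1 := Real.add_one_le_exp (|h (m w) w| / 2 - Real.log (4 * k))
    rw [Real.exp_sub, Real.exp_log (by positivity)] at h1
    have h2 : Real.exp (|h (m w) w| / 2) ≤ ∑ l, Real.exp (|h l w| / 2) :=
      Finset.single_le_sum (f := fun l => Real.exp (|h l w| / 2)) (fun l _ => (Real.exp_pos _).le)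
        (Finset.mem_univ (m w))
    have h3 : Real.exp (|h (m w) w| / 2) / (4 * k) ≤
        (∑ l, Real.exp (|h l w| / 2)) / (4 * k) := by gcongr
    have h4 : 1 / (2 * k) * ∑ l, Real.exp (|h l w| / 2) =
        2 * ((∑ l, Real.exp (|h l w| / 2)) / (4 * k)) := by
      field_simp
      ring
    rw [h4]
    linarith
  calc 𝔼 w, |h (m w) w| ≤ 𝔼 w, (2 * (Real.log (4 * k) - 1) +
        1 / (2 * k) * ∑ l, Real.exp (|h l w| / 2)) := Finset.expect_le_expect fun w _ => hpt w
    _ ≤ 2 * (Real.log (4 * k) - 1) + 1 / (2 * k) * ∑ l : Fin k, 4 := by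
        rw [Finset.expect_add_distrib]
        refine add_le_add (by simp) ?_
        rw [← Finset.mul_expect, Finset.expect_sum_comm]
        gcongr with l
        exact hexp l
    _ = 2 * Real.log (4 * k) := by
        simp
        field_simp
        ring

theorem expect_abs_rademacher_le (a : ι → ℝ) :
    𝔼 ε : ι → ℤˣ, |∑ i, a i * signVal (ε i)| ≤ √(∑ i, a i ^ 2) := by
  have h0 : 0 ≤ ∑ i, a i ^ 2 := Finset.sum_nonneg fun i _ => sq_nonneg _
  rcases h0.eq_or_lt with h | h
  · have : ∀ i, a i = 0 := fun i => pow_eq_zero_iff two_ne_zero |>.1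
      ((Finset.sum_eq_zero_iff_of_nonneg fun i _ => sq_nonneg (a i)).1 h.symm i (Finset.mem_univ i))
    simp [this]
  · have hs := Real.sqrt_pos.2 h
    have hs2 := Real.sq_sqrt h0
    set σ := √(∑ i, a i ^ 2)
    calc 𝔼 ε : ι → ℤˣ, |∑ i, a i * signVal (ε i)|
        ≤ 𝔼 ε : ι → ℤˣ, (1 / (2 * σ) * (∑ i, a i * signVal (ε i)) ^ 2 + σ / 2) := by
          refine Finset.expect_le_expect fun ε _ => ?_
          rw [← sq_abs, ← sub_nonneg]
          have : 1 / (2 * σ) * |∑ i, a i * signVal (ε i)| ^ 2 + σ / 2 -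
              |∑ i, a i * signVal (ε i)| = (|∑ i, a i * signVal (ε i)| - σ) ^ 2 / (2 * σ) := by
            field_simp
            ring
          rw [this]
          positivity
      _ = σ := by
          rw [Finset.expect_add_distrib, ← Finset.mul_expect, expect_rademacher_sq, ← hs2]
          simp
          field_simp
          ring

/-- The minorant `s² / 2 - s⁴ / 54` of `s` turns second moment `1` and fourth moment at most `12`
into `1/2 - 12/54 ≥ 1/4`. -/
theorem le_expect_abs_rademacher {a : ι → ℝ} (ha : ∑ i, a i ^ 2 = 1) :
    1 / 4 ≤ 𝔼 ε : ι → ℤˣ, |∑ i, a i * signVal (ε i)| := by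
  have h2 := expect_rademacher_sq a
  have h4 := expect_rademacher_pow_four_le a ha.le
  calc (1 : ℝ) / 4 ≤ 𝔼 ε : ι → ℤˣ, (1 / 2 * (∑ i, a i * signVal (ε i)) ^ 2 -
        1 / 54 * (∑ i, a i * signVal (ε i)) ^ 4) := by
        rw [Finset.expect_sub_distrib, ← Finset.mul_expect, ← Finset.mul_expect, h2, ha]
        linarith
    _ ≤ _ := by
        refine Finset.expect_le_expect fun ε _ => ?_
        have key : ∀ s : ℝ, 0 ≤ s → 1 / 2 * s ^ 2 - 1 / 54 * s ^ 4 ≤ s := by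
          intro s hs
          -- The difference of the two sides is `s (s - 3)² (s + 6) / 54`.
          nlinarith [mul_nonneg hs (mul_nonneg (sq_nonneg (s - 3)) (by linarith : 0 ≤ s + 6))]
        have h := key _ (abs_nonneg (∑ i, a i * signVal (ε i)))
        rwa [sq_abs, show ∀ t : ℝ, |t| ^ 4 = t ^ 4 from fun t => by
          rw [show 4 = 2 * 2 from rfl, pow_mul, sq_abs, ← pow_mul]] at h

end Bilinear

/-! ### The game `G_n`: normalization and classical communication -/

section RademacherGame

variable {n : ℕ}

theorem rademacherGame_coeff (hn : 0 < n) (w : AliceInput n) (y : BobInput n) :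
    (rademacherGame n hn).coeff w y = 1 / triNorm n * triSum w y := by
  simp only [XORGame.coeff, rademacherGame]
  split_ifs with h
  · rw [signVal_one, abs_of_nonneg h]
    ring
  · rw [signVal_neg, signVal_one, abs_of_neg (not_le.1 h)]
    ring

theorem triSum_eq_rademacher (w : AliceInput n) (y : BobInput n) :
    triSum w y = ∑ p : Fin n × Fin n, signVal (w.1 p.1) * signVal (w.2 p.2) * signVal (y p) := by
  rw [Fintype.sum_prod_type]
  rfl

theorem triNorm_eq_expect (n : ℕ) : triNorm n = Fintype.card (AliceInput n) *
    (Fintype.card (BobInput n) * 𝔼 w : AliceInput n, 𝔼 y : BobInput n, |triSum w y|) := by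
  simp_rw [Fintype.expect_eq_sum_div_card, ← Finset.sum_div]
  rw [triNorm]
  field_simp

theorem expect_abs_triSum_le (w : AliceInput n) : 𝔼 y : BobInput n, |triSum w y| ≤ n := by
  simp_rw [triSum_eq_rademacher]
  refine (expect_abs_rademacher_le _).trans (le_of_eq ?_)
  simp [mul_pow, ← sq]

theorem le_expect_abs_triSum (hn : 0 < n) (w : AliceInput n) :
    (n : ℝ) / 4 ≤ 𝔼 y : BobInput n, |triSum w y| := by
  have hn' : (0 : ℝ) < n := by exact_mod_cast hn
  have h := le_expect_abs_rademacher
    (a := fun p : Fin n × Fin n => signVal (w.1 p.1) * signVal (w.2 p.2) / n) (by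
      simp [mul_pow, div_pow]
      field_simp)
  have h2 : ∀ y : BobInput n, |triSum w y| = n *
      |∑ p : Fin n × Fin n, signVal (w.1 p.1) * signVal (w.2 p.2) / n * signVal (y p)| := by
    intro y
    rw [triSum_eq_rademacher]
    rw [← abs_of_pos hn', ← abs_mul, abs_of_pos hn', Finset.mul_sum]
    congr 1
    refine Finset.sum_congr rfl fun p _ => ?_
    field_simp
  simp_rw [h2, ← Finset.mul_expect]
  calc (n : ℝ) / 4 = n * (1 / 4) := by ring
    _ ≤ _ := mul_le_mul_of_nonneg_left h hn'.le

theorem triNorm_le (n : ℕ) :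
    triNorm n ≤ Fintype.card (AliceInput n) * (Fintype.card (BobInput n) * n) := by
  rw [triNorm_eq_expect]
  gcongr
  refine (Finset.expect_le_expect fun w _ => expect_abs_triSum_le w).trans ?_
  simp

theorem le_triNorm (hn : 0 < n) :
    Fintype.card (AliceInput n) * (Fintype.card (BobInput n) * ((n : ℝ) / 4)) ≤ triNorm n := by
  rw [triNorm_eq_expect]
  gcongr
  refine le_trans ?_ (Finset.expect_le_expect fun w _ => le_expect_abs_triSum hn w)
  simp

theorem sum_abs_rademacher_le {ι : Type*} [Fintype ι] [DecidableEq ι] (a : ι → ℝ) :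
    ∑ ε : ι → ℤˣ, |∑ i, a i * signVal (ε i)| ≤
      Fintype.card (ι → ℤˣ) * √(∑ i, a i ^ 2) := by
  have h := expect_abs_rademacher_le a
  rw [Fintype.expect_eq_sum_div_card, div_le_iff₀ (by exact_mod_cast Fintype.card_pos)] at h
  linarith

/-- For a message `l`, the best answers give `∑ |∑ c l p y_p|` over `y`, at most `σ l` on average.
Each `σ l` is the pairing of `g l` with the bilinear form of coefficients `c l / σ l`. As the `g l`
have disjoint supports, their sum is at most a sum over `w` of one form chosen by `m w`. -/
theorem abs_sum_triSum_deterministic_le {k : ℕ} (hk : 0 < k) (t : AliceInput n → ℤˣ)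
    (m : AliceInput n → Fin k) (s : BobInput n → Fin k → ℤˣ) :
    |∑ w, ∑ y, triSum w y * (signVal (t w) * signVal (s y (m w)))| ≤
      Fintype.card (AliceInput n) * (Fintype.card (BobInput n) * (2 * Real.log (4 * k))) := by
  let g : Fin k → AliceInput n → ℝ := fun l w => if m w = l then signVal (t w) else 0
  let c : Fin k → Fin n × Fin n → ℝ := fun l p =>
    ∑ w : AliceInput n, g l w * (signVal (w.1 p.1) * signVal (w.2 p.2))
  let σ : Fin k → ℝ := fun l => √(∑ p, c l p ^ 2)
  have hσ2 : ∀ l, σ l ^ 2 = ∑ p, c l p ^ 2 := fun l =>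
    Real.sq_sqrt (Finset.sum_nonneg fun p _ => sq_nonneg _)
  have hform : ∀ l (y : BobInput n), ∑ w, g l w * triSum w y = ∑ p, c l p * signVal (y p) := by
    intro l y
    simp_rw [triSum_eq_rademacher, c, Finset.mul_sum, Finset.sum_mul]
    rw [Finset.sum_comm]
    exact Finset.sum_congr rfl fun p _ => Finset.sum_congr rfl fun w _ => by ring
  have hsplit : ∑ w, ∑ y, triSum w y * (signVal (t w) * signVal (s y (m w))) =
      ∑ l, ∑ y, signVal (s y l) * ∑ p, c l p * signVal (y p) := by
    simp_rw [← hform, Finset.mul_sum]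
    rw [Finset.sum_comm, Finset.sum_comm (s := (Finset.univ : Finset (Fin k)))]
    refine Finset.sum_congr rfl fun y _ => ?_
    rw [Finset.sum_comm]
    refine Finset.sum_congr rfl fun w _ => ?_
    rw [Finset.sum_eq_single (m w)]
    · simp only [g, if_true]
      ring
    · intro l _ hl
      simp [g, Ne.symm hl]
    · simp
  have h1 : |∑ w, ∑ y, triSum w y * (signVal (t w) * signVal (s y (m w)))| ≤
      Fintype.card (BobInput n) * ∑ l, σ l := by
    rw [hsplit, Finset.mul_sum]
    refine (Finset.abs_sum_le_sum_abs _ _).trans (Finset.sum_le_sum fun l _ => ?_)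
    refine (Finset.abs_sum_le_sum_abs _ _).trans ?_
    simp_rw [abs_mul, abs_signVal, one_mul]
    exact sum_abs_rademacher_le (c l)
  have h2 : ∀ l, σ l = ∑ w : AliceInput n, g l w *
      ∑ i, ∑ j, c l (i, j) / σ l * signVal (w.1 i) * signVal (w.2 j) := by
    intro l
    have : ∑ w : AliceInput n, g l w *
        ∑ i, ∑ j, c l (i, j) / σ l * signVal (w.1 i) * signVal (w.2 j) =
        (∑ p, c l p * c l p) / σ l := by
      have h3 : ∀ w : AliceInput n, g l w *
          ∑ i, ∑ j, c l (i, j) / σ l * signVal (w.1 i) * signVal (w.2 j) =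
          ∑ p : Fin n × Fin n, c l p / σ l * (g l w * (signVal (w.1 p.1) * signVal (w.2 p.2))) := by
        intro w
        rw [Fintype.sum_prod_type, Finset.mul_sum]
        refine Finset.sum_congr rfl fun i _ => ?_
        rw [Finset.mul_sum]
        exact Finset.sum_congr rfl fun j _ => by ring
      simp_rw [h3]
      rw [Finset.sum_comm, Finset.sum_div]
      simp_rw [← Finset.mul_sum]
      exact Finset.sum_congr rfl fun p _ => by ring
    rw [this]
    simp_rw [← sq, ← hσ2]
    -- If `σ l = 0`, division by zero makes the normalized form vanish and both sides are `0`.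
    rcases eq_or_ne (σ l) 0 with h0 | h0
    · simp [h0]
    · field_simp
  have h3 : ∑ l, σ l ≤ ∑ w : AliceInput n,
      |∑ i, ∑ j, c (m w) (i, j) / σ (m w) * signVal (w.1 i) * signVal (w.2 j)| := by
    calc ∑ l, σ l = ∑ w : AliceInput n, ∑ l, g l w *
          ∑ i, ∑ j, c l (i, j) / σ l * signVal (w.1 i) * signVal (w.2 j) := by
          rw [Finset.sum_comm]
          exact Finset.sum_congr rfl fun l _ => h2 l
      _ ≤ _ := by
          refine Finset.sum_le_sum fun w _ => ?_
          rw [Finset.sum_eq_single (m w)]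
          · simp only [g, if_true]
            refine (le_abs_self _).trans ?_
            rw [abs_mul, abs_signVal, one_mul]
          · intro l _ hl
            simp [g, Ne.symm hl]
          · simp
  have h4 := expect_abs_bilinear_le hk (c := fun l i j => c l (i, j) / σ l) (fun l => by
    simp_rw [div_pow, ← Finset.sum_div]
    rw [← Fintype.sum_prod_type (f := fun p => c l p ^ 2), hσ2]
    exact div_self_le_one _) m
  rw [Fintype.expect_eq_sum_div_card, div_le_iff₀ (by exact_mod_cast Fintype.card_pos)] at h4
  calc _ ≤ _ := h1
    _ ≤ Fintype.card (BobInput n) * (2 * Real.log (4 * k) * Fintype.card (AliceInput n)) := by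
        gcongr
        exact h3.trans h4
    _ = _ := by ring

theorem oneWayClassicalValue_rademacherGame_le (hn : 0 < n) {k : ℕ} (hk : Real.exp 2 ≤ (k : ℝ)) :
    (rademacherGame n hn).oneWayClassicalValue k ≤
      2 * √2 * Real.exp 2 / (n : ℝ) * Real.log k := by
  have hn' : (0 : ℝ) < n := by exact_mod_cast hn
  have hk0 : (0 : ℝ) < k := (Real.exp_pos 2).trans_le hk
  have hk' : 0 < k := by exact_mod_cast hk0
  have hlog : 2 ≤ Real.log k := (Real.le_log_iff_exp_le hk0).2 hk
  -- Here `k ≥ e²` absorbs `log 4 ≤ 2 ≤ log k`. With `M ≥ N n / 4` the bound becomes `16 log k / n`,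
  -- and `16` is below the stated constant.
  have hlog4 : Real.log (4 * k) ≤ 2 * Real.log k := by
    rw [Real.log_mul (by norm_num) hk0.ne']
    have h4 : Real.log 4 ≤ 2 := by
      rw [show (4 : ℝ) = 2 ^ 2 by norm_num, Real.log_pow]
      have := Real.log_two_lt_d9
      push_cast
      linarith
    linarith
  have hconst : 16 ≤ 2 * √2 * Real.exp 2 := by
    have h1 : 1.4 ≤ √2 := Real.le_sqrt_of_sq_le (by norm_num)
    have h2 : 7 ≤ Real.exp 2 := by
      have h := Real.exp_one_gt_d9
      have h2 : Real.exp 2 = Real.exp 1 ^ 2 := by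
        rw [← Real.exp_nat_mul]; norm_num
      nlinarith
    nlinarith
  have hA : (0 : ℝ) < Fintype.card (AliceInput n) := by exact_mod_cast Fintype.card_pos
  have hB : (0 : ℝ) < Fintype.card (BobInput n) := by exact_mod_cast Fintype.card_pos
  have hM := triNorm_pos hn
  have hbound : (0 : ℝ) ≤ 2 * √2 * Real.exp 2 / (n : ℝ) * Real.log k := by positivity
  refine bellValue_le hbound fun P hP =>
    abs_bellPairing_le_of_isOneWayClassical (fun t m s => ?_) hP
  have h := abs_sum_triSum_deterministic_le hk' t m s
  simp_rw [rademacherGame_coeff, mul_assoc, ← Finset.mul_sum]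
  rw [abs_mul, abs_of_pos (by positivity), div_mul_eq_mul_div, one_mul, div_le_iff₀ hM]
  refine h.trans ?_
  calc Fintype.card (AliceInput n) * (Fintype.card (BobInput n) * (2 * Real.log (4 * k)))
      ≤ Fintype.card (AliceInput n) * (Fintype.card (BobInput n) * (4 * Real.log k)) := by
        refine mul_le_mul_of_nonneg_left (mul_le_mul_of_nonneg_left ?_ hB.le) hA.le
        linarith
    _ = 16 / n * Real.log k *
        (Fintype.card (AliceInput n) * (Fintype.card (BobInput n) * ((n : ℝ) / 4))) := by
        field_simp
        ring
    _ ≤ 2 * √2 * Real.exp 2 / n * Real.log k * triNorm n := by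
        gcongr
        exact le_triNorm hn
    _ = _ := by ring

end RademacherGame

/-! ### A bounded observable correlated with a symmetric matrix -/

section Observable

variable {ι : Type*} [Fintype ι]

/-- The contraction `2 t (1 + t²)⁻¹` correlates with the symmetric matrix `t`. -/
theorem exists_contraction_trace_mul_ge [DecidableEq ι] {t : Matrix ι ι ℝ} (ht : t.transpose = t) :
    ∃ B : Matrix ι ι ℝ, (1 + B).PosSemidef ∧ (1 - B).PosSemidef ∧
      2 * ((t * t).trace - (t * t * (t * t)).trace) ≤ (t * B).trace := by
  have htH : t.conjTranspose = t := by
    rw [Matrix.conjTranspose_eq_transpose_of_trivial, ht]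
  have hPos : (1 + t * t).PosDef := by
    refine Matrix.PosDef.one.add_posSemidef ?_
    have h := Matrix.posSemidef_conjTranspose_mul_self t
    rwa [htH] at h
  have hdet : IsUnit (1 + t * t).det := (Matrix.isUnit_iff_isUnit_det _).1 hPos.isUnit
  set R := (1 + t * t)⁻¹ with hRdef
  have hR : R.PosSemidef := hPos.posSemidef.inv
  have hRP : R * (1 + t * t) = 1 := Matrix.nonsing_inv_mul _ hdet
  have hPR : (1 + t * t) * R = 1 := Matrix.mul_nonsing_inv _ hdet
  have hcomm : t * R = R * t := by
    calc t * R = R * (1 + t * t) * (t * R) := by rw [hRP, one_mul]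
      _ = R * t * ((1 + t * t) * R) := by noncomm_ring
      _ = R * t := by rw [hPR, mul_one]
  have hRtt : R * (t * t) = 1 - R := by
    rw [eq_sub_iff_add_eq', ← hRP]
    noncomm_ring
  refine ⟨(2 : ℝ) • (t * R), ?_, ?_, ?_⟩
  -- `1 ± 2 t R = (1 ± t) R (1 ± t)`, because `(1 ± t)² = 1 + t² ± 2 t` and `R` inverts `1 + t²`.
  · have h := hR.mul_mul_conjTranspose_same (1 + t)
    have h2 : (1 + t) * R * (1 + t).conjTranspose = 1 + (2 : ℝ) • (t * R) := by
      rw [Matrix.conjTranspose_add, Matrix.conjTranspose_one, htH]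
      calc (1 + t) * R * (1 + t) = R + t * R + R * t + t * R * t := by noncomm_ring
        _ = R + t * R + t * R + R * (t * t) := by rw [hcomm, mul_assoc R]
        _ = 1 + (2 : ℝ) • (t * R) := by rw [hRtt, two_smul]; abel
    rwa [h2] at h
  · have h := hR.mul_mul_conjTranspose_same (1 - t)
    have h2 : (1 - t) * R * (1 - t).conjTranspose = 1 - (2 : ℝ) • (t * R) := by
      rw [Matrix.conjTranspose_sub, Matrix.conjTranspose_one, htH]
      calc (1 - t) * R * (1 - t) = R - t * R - R * t + t * R * t := by noncomm_ring
        _ = R - t * R - t * R + R * (t * t) := by rw [hcomm, mul_assoc R]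
        _ = 1 - (2 : ℝ) • (t * R) := by rw [hRtt, two_smul]; abel
    rwa [h2] at h
  -- The identity `t² R = t² - t⁴ + t³ R t³` has a positive remainder, so only the second and fourth
  -- moments of `t` are needed.
  · have h := (hR.mul_mul_conjTranspose_same (t * t * t)).trace_nonneg
    have h2 : t * t * t * R * (t * t * t).conjTranspose =
        t * (t * R) - t * t + t * t * (t * t) := by
      simp only [Matrix.conjTranspose_mul, htH]
      calc t * t * t * R * (t * (t * t)) = t * t * (t * R) * (t * (t * t)) := by noncomm_ring
        _ = t * t * (R * (t * t)) * (t * t) := by rw [hcomm]; noncomm_ring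
        _ = t * t * (1 - R) * (t * t) := by rw [hRtt]
        _ = t * t * (t * t) - t * t * (R * (t * t)) := by noncomm_ring
        _ = t * t * (t * t) - t * t * (1 - R) := by rw [hRtt]
        _ = _ := by noncomm_ring
    rw [h2, Matrix.trace_add, Matrix.trace_sub] at h
    rw [Matrix.mul_smul, Matrix.trace_smul, smul_eq_mul]
    linarith

/-- By polarization the symmetrized form is half the difference of the quadratic form at `x + z` and
`x - z`, whose squared norms add up to `4 r`. One of the two pure states, with sign `1` or `-1`
respectively, must reach the average. -/
theorem exists_state_ge {M : Matrix ι ι ℝ} {x z : ι → ℝ} {r : ℝ} (hr : 0 < r)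
    (hx : x ⬝ᵥ x = r) (hz : z ⬝ᵥ z = r) :
    ∃ (α : ℤˣ) (ρ : Matrix ι ι ℂ), ρ.PosSemidef ∧ ρ.trace = 1 ∧
      (x ⬝ᵥ M.mulVec z + z ⬝ᵥ M.mulVec x) / (2 * r) ≤
        signVal α * (M.map Complex.ofReal * ρ).trace.re := by
  set c := (x ⬝ᵥ M.mulVec z + z ⬝ᵥ M.mulVec x) / (2 * r) with hc
  by_contra! hcon
  have hstate : ∀ v : ι → ℝ, 0 < v ⬝ᵥ v → ∀ α, signVal α * (v ⬝ᵥ M.mulVec v) < c * (v ⬝ᵥ v) := by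
    intro v hv α
    let ρ : Matrix ι ι ℝ := (v ⬝ᵥ v)⁻¹ • Matrix.vecMulVec v v
    have hρ : ρ.PosSemidef := by
      refine Matrix.PosSemidef.smul ?_ (inv_nonneg.2 hv.le)
      simpa using Matrix.posSemidef_vecMulVec_self_star v
    have h := hcon α (ρ.map Complex.ofReal) hρ.map_ofReal ?_
    · have h2 : (M.map Complex.ofReal * ρ.map Complex.ofReal).trace.re =
          (v ⬝ᵥ M.mulVec v) / (v ⬝ᵥ v) := by
        have h3 : (M.map Complex.ofReal * ρ.map Complex.ofReal).trace =
            (((M * ρ).trace : ℝ) : ℂ) := by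
          simp [Matrix.trace, Matrix.mul_apply]
        rw [h3, Complex.ofReal_re, Matrix.mul_smul, Matrix.trace_smul, Matrix.mul_vecMulVec,
          Matrix.trace_vecMulVec, smul_eq_mul, dotProduct_comm (M.mulVec v) v,
          div_eq_inv_mul]
      rw [h2, mul_div_assoc', div_lt_iff₀ hv] at h
      exact h
    · have h3 : (ρ.map Complex.ofReal).trace = ((ρ.trace : ℝ) : ℂ) := by
        simp [Matrix.trace]
      rw [h3, Matrix.trace_smul, Matrix.trace_vecMulVec, smul_eq_mul, inv_mul_cancel₀ hv.ne',
        Complex.ofReal_one]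
  have hle : ∀ v : ι → ℝ, ∀ α, signVal α * (v ⬝ᵥ M.mulVec v) ≤ c * (v ⬝ᵥ v) := by
    intro v α
    rcases eq_or_ne v 0 with rfl | hv
    · simp
    · exact (hstate v (by simpa using Matrix.dotProduct_star_self_pos_iff.2 hv) α).le
  have h1 := hle (x + z) 1
  have h2 := hle (x - z) (-1)
  have hsum : (x + z) ⬝ᵥ (x + z) + (x - z) ⬝ᵥ (x - z) = 4 * r := by
    simp only [add_dotProduct, dotProduct_add, sub_dotProduct, dotProduct_sub, hx, hz]
    ring
  have hpol : (x + z) ⬝ᵥ M.mulVec (x + z) - (x - z) ⬝ᵥ M.mulVec (x - z) = 4 * r * c := by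
    simp only [Matrix.mulVec_add, Matrix.mulVec_sub, add_dotProduct, dotProduct_add, sub_dotProduct,
      dotProduct_sub, hc]
    field_simp
    ring
  simp only [signVal_one, signVal_neg, one_mul, neg_mul] at h1 h2
  -- One of the two vectors may be zero and then gives no state, but not both, so one of the summed
  -- inequalities is strict.
  have hstrict : 0 < (x + z) ⬝ᵥ (x + z) ∨ 0 < (x - z) ⬝ᵥ (x - z) := by
    by_contra! h
    linarith
  have hcsum : c * ((x + z) ⬝ᵥ (x + z)) + c * ((x - z) ⬝ᵥ (x - z)) = 4 * r * c := by
    rw [← mul_add, hsum]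
    ring
  rcases hstrict with h | h
  · have h3 := hstate _ h 1
    simp only [signVal_one, one_mul] at h3
    linarith
  · have h3 := hstate _ h (-1)
    simp only [signVal_one, signVal_neg, one_mul, neg_mul] at h3
    linarith

end Observable

/-! ### Moments of random sign matrices -/

section SignMatrix

variable {n : ℕ}

/-- The sign matrix given to Bob. -/
def signMatrix (y : BobInput n) : Matrix (Fin n) (Fin n) ℝ :=
  Matrix.of fun i j => signVal (y (i, j))

/-- The symmetrization of a matrix. -/
noncomputable def symmetrization (A : Matrix (Fin n) (Fin n) ℝ) : Matrix (Fin n) (Fin n) ℝ :=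
  (1 / 2 : ℝ) • (A + A.transpose)

theorem symmetrization_transpose (A : Matrix (Fin n) (Fin n) ℝ) :
    (symmetrization A).transpose = symmetrization A := by
  rw [symmetrization, Matrix.transpose_smul, Matrix.transpose_add, Matrix.transpose_transpose,
    add_comm]

theorem trace_mul_transpose_eq_sum_sq (A : Matrix (Fin n) (Fin n) ℝ) :
    (A * A.transpose).trace = ∑ i, ∑ j, A i j ^ 2 := by
  simp [Matrix.trace, Matrix.mul_apply, sq]

/-- A squared entry is `(1 + y_ij y_ji) / 2`, of mean `1/2` off the diagonal and `1` on it. -/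
theorem le_expect_trace_symmetrization_sq (n : ℕ) : (n : ℝ) ^ 2 / 2 ≤
    𝔼 y : BobInput n,
      (symmetrization (signMatrix y) * symmetrization (signMatrix y)).trace := by
  have h : ∀ y : BobInput n,
      (symmetrization (signMatrix y) * symmetrization (signMatrix y)).trace =
        ∑ i, ∑ j, (1 / 2 + 1 / 2 * (signVal (y (i, j)) * signVal (y (j, i)))) := by
    intro y
    nth_rw 2 [← symmetrization_transpose]
    rw [trace_mul_transpose_eq_sum_sq]
    refine Finset.sum_congr rfl fun i _ => Finset.sum_congr rfl fun j _ => ?_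
    simp only [symmetrization, signMatrix, Matrix.smul_apply, Matrix.add_apply,
      Matrix.transpose_apply, Matrix.of_apply, smul_eq_mul]
    have h1 := signVal_sq (y (i, j))
    have h2 := signVal_sq (y (j, i))
    linear_combination (1 / 4) * h1 + (1 / 4) * h2
  simp_rw [h, Finset.expect_sum_comm]
  have h2 : ∀ i j : Fin n, (1 / 2 : ℝ) ≤
      𝔼 y : BobInput n, (1 / 2 + 1 / 2 * (signVal (y (i, j)) * signVal (y (j, i)))) := by
    intro i j
    rw [Finset.expect_add_distrib, ← Finset.mul_expect, expect_signVal_mul]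
    simp
    split_ifs <;> norm_num
  refine le_trans (le_of_eq ?_) (Finset.sum_le_sum fun i _ => Finset.sum_le_sum fun j _ => h2 i j)
  simp
  ring

/-- `S²` is the average of `AA, AAᵀ, AᵀA, AᵀAᵀ`, and each has Hilbert–Schmidt norm at most that of
`AAᵀ`. For `AA` this holds because cyclicity gives `‖AA‖² = ⟨AAᵀ, AᵀA⟩`, where both factors have
equal norm. -/
theorem trace_symmetrization_pow_four_le (A : Matrix (Fin n) (Fin n) ℝ) :
    (symmetrization A * symmetrization A * (symmetrization A * symmetrization A)).trace ≤
      ∑ i, ∑ k, (A * A.transpose) i k ^ 2 := by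
  set B := A.transpose with hB
  have hBt : B.transpose = A := Matrix.transpose_transpose A
  have hfr : ∀ M N : Matrix (Fin n) (Fin n) ℝ, ∑ i, ∑ j, (M * N) i j ^ 2 =
      (M * N * (N.transpose * M.transpose)).trace := by
    intro M N
    rw [← Matrix.transpose_mul, trace_mul_transpose_eq_sum_sq]
  have hBA : ∑ i, ∑ j, (B * A) i j ^ 2 = ∑ i, ∑ j, (A * B) i j ^ 2 := by
    rw [hfr, hfr, ← hB, hBt, mul_assoc, Matrix.trace_mul_comm]
    simp only [mul_assoc]
  have hAA : ∑ i, ∑ j, (A * A) i j ^ 2 ≤ ∑ i, ∑ j, (A * B) i j ^ 2 := by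
    have h1 : 0 ≤ ∑ i, ∑ j, (A * B - B * A) i j ^ 2 :=
      Finset.sum_nonneg fun i _ => Finset.sum_nonneg fun j _ => sq_nonneg _
    have h2 : ∑ i, ∑ j, (A * A) i j ^ 2 = ∑ i, ∑ j, (A * B) i j * (B * A) i j := by
      have h3 : ∑ i, ∑ j, (A * B) i j * (B * A) i j = (A * B * (B * A)).trace := by
        simp only [Matrix.trace, Matrix.diag]
        refine Finset.sum_congr rfl fun i _ => ?_
        rw [Matrix.mul_apply]
        refine Finset.sum_congr rfl fun j _ => ?_
        congr 1
        rw [← Matrix.transpose_apply (B * A), Matrix.transpose_mul, ← hB, hBt]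
      rw [hfr, h3, ← hB, mul_assoc A A, Matrix.trace_mul_comm A]
      simp only [mul_assoc]
    have h4 : ∑ i, ∑ j, (A * B - B * A) i j ^ 2 = ∑ i, ∑ j, (A * B) i j ^ 2 -
        2 * ∑ i, ∑ j, (A * B) i j * (B * A) i j + ∑ i, ∑ j, (B * A) i j ^ 2 := by
      simp only [Finset.mul_sum, ← Finset.sum_add_distrib, ← Finset.sum_sub_distrib]
      refine Finset.sum_congr rfl fun i _ => Finset.sum_congr rfl fun j _ => ?_
      rw [Matrix.sub_apply]
      ring
    rw [h4, hBA, ← h2] at h1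
    linarith
  have hBB : ∑ i, ∑ j, (B * B) i j ^ 2 = ∑ i, ∑ j, (A * A) i j ^ 2 := by
    rw [hB, ← Matrix.transpose_mul, Finset.sum_comm]
    rfl
  have hS : symmetrization A * symmetrization A =
      (1 / 4 : ℝ) • (A * A + A * B + B * A + B * B) := by
    rw [symmetrization, Matrix.smul_mul, Matrix.mul_smul, smul_smul, ← hB,
      show (A + B) * (A + B) = A * A + A * B + B * A + B * B by noncomm_ring]
    norm_num
  have hSt : (symmetrization A * symmetrization A).transpose =
      symmetrization A * symmetrization A := by
    rw [Matrix.transpose_mul, symmetrization_transpose]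
  nth_rw 2 [← hSt]
  rw [trace_mul_transpose_eq_sum_sq, hS]
  calc ∑ i, ∑ j, ((1 / 4 : ℝ) • (A * A + A * B + B * A + B * B)) i j ^ 2
      ≤ ∑ i, ∑ j, (1 / 4) * ((A * A) i j ^ 2 + (A * B) i j ^ 2 + (B * A) i j ^ 2 +
          (B * B) i j ^ 2) := by
        refine Finset.sum_le_sum fun i _ => Finset.sum_le_sum fun j _ => ?_
        simp only [Matrix.smul_apply, Matrix.add_apply, smul_eq_mul]
        nlinarith [sq_nonneg ((A * A) i j - (A * B) i j), sq_nonneg ((A * A) i j - (B * A) i j),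
          sq_nonneg ((A * A) i j - (B * B) i j), sq_nonneg ((A * B) i j - (B * A) i j),
          sq_nonneg ((A * B) i j - (B * B) i j), sq_nonneg ((B * A) i j - (B * B) i j)]
    _ = (1 / 4) * (∑ i, ∑ j, (A * A) i j ^ 2 + ∑ i, ∑ j, (A * B) i j ^ 2 +
          ∑ i, ∑ j, (B * A) i j ^ 2 + ∑ i, ∑ j, (B * B) i j ^ 2) := by
        simp only [← Finset.sum_add_distrib, Finset.mul_sum]
    _ ≤ _ := by
        rw [hBA, hBB]
        linarith

/-- Rows of a sign matrix are orthogonal on average. -/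
theorem expect_row_inner_sq {i k : Fin n} (hik : i ≠ k) :
    𝔼 y : BobInput n, (∑ j, signVal (y (i, j)) * signVal (y (k, j))) ^ 2 = n := by
  -- Multiplying row `k` by row `i` is an involution that turns the inner product of the two rows
  -- into the plain sum of row `k`.
  let f : BobInput n → BobInput n := fun y p => if p.1 = k then y (i, p.2) * y p else y p
  have hf : Function.Involutive f := by
    intro y
    ext p
    by_cases hp : p.1 = k
    · simp [f, hp, hik, ← mul_assoc]
    · simp [f, hp]
  rw [Fintype.expect_equiv hf.toPerm _ fun y => (∑ j, signVal (y (k, j))) ^ 2]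
  · have h := expect_rademacher_sq fun p : Fin n × Fin n => if p.1 = k then (1 : ℝ) else 0
    simp only [Fintype.sum_prod_type, ite_mul, one_mul, zero_mul] at h
    have h2 : ∀ g : Fin n → Fin n → ℝ, ∑ a, ∑ b, (if a = k then g a b else 0) = ∑ b, g k b := by
      intro g
      rw [Finset.sum_eq_single k]
      · simp
      · intro a _ ha
        simp [ha]
      · simp
    simp only [h2 fun a b => signVal _] at h
    rw [h]
    simp
  · intro y
    congr 1
    refine Finset.sum_congr rfl fun j _ => ?_
    simp [f]

theorem expect_sum_mul_transpose_sq_le (n : ℕ) :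
    𝔼 y : BobInput n, ∑ i, ∑ k, (signMatrix y * (signMatrix y).transpose) i k ^ 2 ≤
      2 * (n : ℝ) ^ 3 := by
  simp_rw [Finset.expect_sum_comm]
  have h : ∀ i k : Fin n,
      𝔼 y : BobInput n, (signMatrix y * (signMatrix y).transpose) i k ^ 2 ≤
        n + if i = k then (n : ℝ) ^ 2 else 0 := by
    intro i k
    simp only [Matrix.mul_apply, signMatrix, Matrix.transpose_apply, Matrix.of_apply]
    split_ifs with hik
    · subst hik
      simp
    · rw [expect_row_inner_sq hik, add_zero]
  refine (Finset.sum_le_sum fun i _ => Finset.sum_le_sum fun k _ => h i k).trans (le_of_eq ?_)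
  simp [Finset.sum_add_distrib]
  ring

end SignMatrix

/-! ### The game `G_n`: a one-way quantum strategy -/

section RademacherGame

variable {n : ℕ}

/-- Orthogonality of the characters `x_i z_j`: averaging over Alice's inputs reads off one entry of
Bob's matrix. -/
theorem expect_triSum_mul (y : BobInput n) (i j : Fin n) :
    𝔼 w : AliceInput n, triSum w y * (signVal (w.1 i) * signVal (w.2 j)) = signVal (y (i, j)) := by
  have h : ∀ w : AliceInput n, triSum w y * (signVal (w.1 i) * signVal (w.2 j)) =
      ∑ a, ∑ b, signVal (y (a, b)) *
        ((signVal (w.1 a) * signVal (w.1 i)) * (signVal (w.2 b) * signVal (w.2 j))) := by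
    intro w
    simp_rw [triSum, Finset.sum_mul]
    exact Finset.sum_congr rfl fun a _ => Finset.sum_congr rfl fun b _ => by ring
  simp_rw [h, Finset.expect_sum_comm, ← Finset.mul_expect, expect_prod_type, ← Finset.mul_expect,
    ← Finset.expect_mul, expect_signVal_mul]
  simp

/-- The contraction is applied to `S / √(8n)`. On average the second moment then contributes at
least `n / 16` and the fourth at most `n / 32`, so the scale `8` keeps the difference positive. -/
theorem exists_observable (y : BobInput n) (hn : 0 < n) :
    ∃ B : Matrix (Fin n) (Fin n) ℝ, (1 + B).PosSemidef ∧ (1 - B).PosSemidef ∧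
      2 * √(8 * n) * ((symmetrization (signMatrix y) * symmetrization (signMatrix y)).trace / (8 * n) -
        (∑ i, ∑ k, (signMatrix y * (signMatrix y).transpose) i k ^ 2) / (64 * n ^ 2)) ≤
        (symmetrization (signMatrix y) * B).trace := by
  have hn' : (0 : ℝ) < n := by exact_mod_cast hn
  set S := symmetrization (signMatrix y) with hS
  have hs : 0 < √(8 * n : ℝ) := Real.sqrt_pos.2 (by positivity)
  have hs2 : √(8 * n : ℝ) ^ 2 = 8 * n := Real.sq_sqrt (by positivity)
  obtain ⟨B, h1, h2, h3⟩ := exists_contraction_trace_mul_ge (t := (√(8 * n : ℝ))⁻¹ • S) (by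
    rw [Matrix.transpose_smul, symmetrization_transpose])
  refine ⟨B, h1, h2, ?_⟩
  simp only [Matrix.smul_mul, Matrix.mul_smul, smul_smul, Matrix.trace_smul, smul_eq_mul] at h3
  have h4 := trace_symmetrization_pow_four_le (signMatrix y)
  rw [← hS] at h4
  have h5 : (√(8 * n : ℝ))⁻¹ * (√(8 * n : ℝ))⁻¹ = 1 / (8 * n) := by
    rw [← mul_inv, ← sq, hs2, one_div]
  rw [h5, inv_mul_eq_div, le_div_iff₀ hs] at h3
  refine le_trans ?_ h3
  have h6 : (S * S * (S * S)).trace / (64 * n ^ 2) ≤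
      (∑ i, ∑ k, (signMatrix y * (signMatrix y).transpose) i k ^ 2) / (64 * n ^ 2) := by
    gcongr
  have h7 : (1 : ℝ) / (8 * n) * (S * S).trace - 1 / (8 * n) * (1 / (8 * n)) * (S * S * (S * S)).trace =
      (S * S).trace / (8 * n) - (S * S * (S * S)).trace / (64 * n ^ 2) := by
    field_simp
    ring
  rw [h7, mul_right_comm 2]
  gcongr

theorem sum_dotProduct_mulVec (B : BobInput n → Matrix (Fin n) (Fin n) ℝ) :
    ∑ w : AliceInput n, ((fun i => signVal (w.1 i)) ⬝ᵥ
        (∑ y, triSum w y • B y).mulVec (fun j => signVal (w.2 j)) +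
      (fun j => signVal (w.2 j)) ⬝ᵥ
        (∑ y, triSum w y • B y).mulVec (fun i => signVal (w.1 i))) =
      2 * Fintype.card (AliceInput n) * ∑ y, (symmetrization (signMatrix y) * B y).trace := by
  have h1 : ∀ w : AliceInput n, ((fun i => signVal (w.1 i)) ⬝ᵥ
        (∑ y, triSum w y • B y).mulVec (fun j => signVal (w.2 j)) +
      (fun j => signVal (w.2 j)) ⬝ᵥ
        (∑ y, triSum w y • B y).mulVec (fun i => signVal (w.1 i))) =
      ∑ y, ∑ i, ∑ j, triSum w y * (signVal (w.1 i) * signVal (w.2 j)) * (B y i j + B y j i) := by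
    intro w
    have h2 : ∀ (a b : Fin n → ℝ), a ⬝ᵥ (∑ y, triSum w y • B y).mulVec b =
        ∑ y, ∑ i, ∑ j, triSum w y * (a i * b j) * B y i j := by
      intro a b
      simp only [Matrix.sum_mulVec, Matrix.smul_mulVec, dotProduct_sum, dotProduct_smul,
        smul_eq_mul]
      refine Finset.sum_congr rfl fun y _ => ?_
      simp only [dotProduct, Matrix.mulVec, Finset.mul_sum]
      exact Finset.sum_congr rfl fun i _ => Finset.sum_congr rfl fun j _ => by ring
    rw [h2, h2, ← Finset.sum_add_distrib]
    refine Finset.sum_congr rfl fun y _ => ?_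
    rw [Finset.sum_comm (f := fun i j => triSum w y * (signVal (w.2 i) * signVal (w.1 j)) * B y i j),
      ← Finset.sum_add_distrib]
    refine Finset.sum_congr rfl fun i _ => ?_
    rw [← Finset.sum_add_distrib]
    exact Finset.sum_congr rfl fun j _ => by ring
  have h3 : ∀ y i j, ∑ w : AliceInput n, triSum w y * (signVal (w.1 i) * signVal (w.2 j)) =
      Fintype.card (AliceInput n) * signVal (y (i, j)) := by
    intro y i j
    have h := expect_triSum_mul y i j
    rw [Fintype.expect_eq_sum_div_card, div_eq_iff (by exact_mod_cast Fintype.card_ne_zero)] at h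
    rw [h, mul_comm]
  simp_rw [h1]
  rw [Finset.sum_comm, Finset.mul_sum]
  refine Finset.sum_congr rfl fun y _ => ?_
  rw [Finset.sum_comm]
  have h4 : ∀ i, ∑ w : AliceInput n, ∑ j,
      triSum w y * (signVal (w.1 i) * signVal (w.2 j)) * (B y i j + B y j i) =
      ∑ j, Fintype.card (AliceInput n) * signVal (y (i, j)) * (B y i j + B y j i) := by
    intro i
    rw [Finset.sum_comm]
    refine Finset.sum_congr rfl fun j _ => ?_
    rw [← Finset.sum_mul, h3]
  simp_rw [h4]
  have h5 : (symmetrization (signMatrix y) * B y).trace =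
      ∑ i, ∑ j, 1 / 2 * (signVal (y (i, j)) * (B y i j + B y j i)) := by
    simp only [Matrix.trace, Matrix.diag, Matrix.mul_apply, symmetrization, signMatrix,
      Matrix.smul_apply, Matrix.add_apply, Matrix.transpose_apply, Matrix.of_apply, smul_eq_mul]
    have h6 : ∀ i j, 1 / 2 * (signVal (y (i, j)) + signVal (y (j, i))) * B y j i =
        1 / 2 * (signVal (y (i, j)) * B y j i) + 1 / 2 * (signVal (y (j, i)) * B y j i) :=
      fun i j => by ring
    simp_rw [h6, Finset.sum_add_distrib]
    rw [Finset.sum_comm (f := fun i j => 1 / 2 * (signVal (y (j, i)) * B y j i)),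
      ← Finset.sum_add_distrib]
    refine Finset.sum_congr rfl fun i _ => ?_
    rw [← Finset.sum_add_distrib]
    exact Finset.sum_congr rfl fun j _ => by ring
  rw [h5, Finset.mul_sum]
  refine Finset.sum_congr rfl fun i _ => ?_
  rw [Finset.mul_sum]
  exact Finset.sum_congr rfl fun j _ => by ring

theorem le_oneWayQuantumValue_rademacherGame (hn : 0 < n) :
    1 / 8 / √(n : ℝ) ≤ (rademacherGame n hn).oneWayQuantumValue n := by
  have hn' : (0 : ℝ) < n := by exact_mod_cast hn
  have hA : (0 : ℝ) < Fintype.card (AliceInput n) := by exact_mod_cast Fintype.card_pos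
  have hB : (0 : ℝ) < Fintype.card (BobInput n) := by exact_mod_cast Fintype.card_pos
  have hM := triNorm_pos hn
  choose B hB1 hB2 hB3 using fun y : BobInput n => exists_observable y hn
  -- Bob's observables are fixed first; Alice then answers the payoff matrix they produce at her
  -- input, with `r = n` as the squared length of sign vectors.
  choose α ρ hρ1 hρ2 hρ3 using fun w : AliceInput n => exists_state_ge
    (M := ∑ y, triSum w y • B y) (x := fun i => signVal (w.1 i)) (z := fun j => signVal (w.2 j))
    hn' (by simp [dotProduct]) (by simp [dotProduct])
  let F : BobInput n → ℤˣ → Matrix (Fin n) (Fin n) ℂ := fun y b =>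
    ((1 / 2 : ℝ) • (1 + signVal b • B y)).map Complex.ofReal
  have hF : ∀ y, (∀ b, (F y b).PosSemidef) ∧ ∑ b, F y b = 1 := by
    intro y
    refine ⟨fun b => Matrix.PosSemidef.map_ofReal (Matrix.PosSemidef.smul ?_ (by norm_num)), ?_⟩
    · rcases Int.units_eq_one_or b with rfl | rfl
      · simpa using hB1 y
      · simpa [sub_eq_add_neg] using hB2 y
    · rw [sum_units_int]
      ext i j
      by_cases hij : i = j
      · subst hij
        simp [F]
        ring
      · simp [F, Matrix.one_apply_ne hij]
  have hFsub : ∀ y, F y 1 - F y (-1) = (B y).map Complex.ofReal := by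
    intro y
    ext i j
    simp [F]
    ring
  have hval := le_bellValue (B := (rademacherGame n hn).functional)
    (fun P hP => abs_bellPairing_le_of_isOneWayQuantum
      (abs_oneWayQuantum_le_sqrt_mul_quantumValue hn) hP)
    (isOneWayQuantum_deterministic α ρ F (fun w => ⟨hρ1 w, hρ2 w⟩) hF)
  refine le_trans ?_ ((le_abs_self _).trans hval)
  rw [bellPairing_functional]
  simp_rw [correlation_oneWayQuantum, hFsub, rademacherGame_coeff]
  have hpay : ∀ w, ∑ y, 1 / triNorm n * triSum w y *
      (signVal (α w) * ((B y).map Complex.ofReal * ρ w).trace.re) =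
      1 / triNorm n * (signVal (α w) *
        ((∑ y, triSum w y • B y).map Complex.ofReal * ρ w).trace.re) := by
    intro w
    have h : ((∑ y, triSum w y • B y).map Complex.ofReal * ρ w).trace.re =
        ∑ y, triSum w y * ((B y).map Complex.ofReal * ρ w).trace.re := by
      have h2 : (∑ y, triSum w y • B y).map Complex.ofReal =
          ∑ y, (triSum w y : ℂ) • (B y).map Complex.ofReal := by
        ext i j
        simp [Matrix.sum_apply]
      rw [h2, Finset.sum_mul, Matrix.trace_sum, Complex.re_sum]
      refine Finset.sum_congr rfl fun y _ => ?_
      rw [Matrix.smul_mul, Matrix.trace_smul, smul_eq_mul, Complex.re_ofReal_mul]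
    rw [h, Finset.mul_sum, Finset.mul_sum]
    exact Finset.sum_congr rfl fun y _ => by ring
  simp_rw [hpay, ← Finset.mul_sum]
  have hsum := Finset.sum_le_sum fun w (_ : w ∈ Finset.univ) => hρ3 w
  rw [← Finset.sum_div, sum_dotProduct_mulVec] at hsum
  have hmom : Fintype.card (BobInput n) * (√(8 * n : ℝ) * (n / 16)) ≤
      ∑ y, (symmetrization (signMatrix y) * B y).trace := by
    have h := Finset.expect_le_expect fun y (_ : y ∈ Finset.univ) => hB3 y
    rw [← Finset.mul_expect, Finset.expect_sub_distrib, ← Finset.expect_div,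
      ← Finset.expect_div] at h
    have h2 : √(8 * n : ℝ) * (n / 16) ≤ 𝔼 y, (symmetrization (signMatrix y) * B y).trace := by
      refine le_trans ?_ h
      have h3 : ((n : ℝ) ^ 2 / 2) / (8 * n) ≤ (𝔼 y : BobInput n,
          (symmetrization (signMatrix y) * symmetrization (signMatrix y)).trace) / (8 * n) :=
        div_le_div_of_nonneg_right (le_expect_trace_symmetrization_sq n) (by positivity)
      have h4 : (𝔼 y : BobInput n, ∑ i, ∑ k,
          (signMatrix y * (signMatrix y).transpose) i k ^ 2) / (64 * n ^ 2) ≤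
          (2 * (n : ℝ) ^ 3) / (64 * n ^ 2) :=
        div_le_div_of_nonneg_right (expect_sum_mul_transpose_sq_le n) (by positivity)
      have h5 : ((n : ℝ) ^ 2 / 2) / (8 * n) - (2 * (n : ℝ) ^ 3) / (64 * n ^ 2) = n / 32 := by
        field_simp
        norm_num
      calc √(8 * n : ℝ) * (n / 16) = 2 * √(8 * n : ℝ) * (n / 32) := by ring
        _ ≤ _ := mul_le_mul_of_nonneg_left (by linarith) (by positivity)
    rw [Fintype.expect_eq_sum_div_card, le_div_iff₀ hB] at h2
    linarith
  have hsqrt : 2 * √(n : ℝ) ≤ √(8 * n : ℝ) := by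
    apply Real.le_sqrt_of_sq_le
    rw [mul_pow, Real.sq_sqrt hn'.le]
    linarith
  have hs : 0 < √(n : ℝ) := Real.sqrt_pos.2 hn'
  have hs2 := Real.sq_sqrt hn'.le
  rw [div_mul_eq_mul_div, one_mul, le_div_iff₀ hM]
  refine le_trans ?_ hsum
  rw [le_div_iff₀ (by positivity)]
  calc 1 / 8 / √(n : ℝ) * triNorm n * (2 * n)
      ≤ 1 / 8 / √(n : ℝ) *
        (Fintype.card (AliceInput n) * (Fintype.card (BobInput n) * n)) * (2 * n) := by
        gcongr
        exact triNorm_le n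
    _ = 2 * Fintype.card (AliceInput n) *
        (Fintype.card (BobInput n) * (2 * √(n : ℝ) * (n / 16))) := by
        field_simp
        rw [hs2]
        ring
    _ ≤ 2 * Fintype.card (AliceInput n) *
        (Fintype.card (BobInput n) * (√(8 * n : ℝ) * (n / 16))) := by
        gcongr
    _ ≤ _ := by gcongr

end RademacherGame

/-! ### Assembly of both parts of the theorem. -/

theorem theorem3 :
    (∃ C : ℝ, 0 < C ∧ ∀ (n : ℕ) (hn : 0 < n),
      Fintype.card (AliceInput n) = 2 ^ (2 * n) ∧
      Fintype.card (BobInput n) = 2 ^ (n ^ 2) ∧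
      (∀ (w : AliceInput n) (y : BobInput n),
        (rademacherGame n hn).coeff w y = 1 / triNorm n * triSum w y) ∧
      C / √(n : ℝ) ≤ (rademacherGame n hn).oneWayQuantumValue n ∧
      ∀ k : ℕ, Real.exp 2 ≤ (k : ℝ) →
        (rademacherGame n hn).oneWayClassicalValue k ≤
          2 * √2 * Real.exp 2 / (n : ℝ) * Real.log k ∧
        C * (√(n : ℝ) / Real.log k) ≤
          (rademacherGame n hn).oneWayQuantumValue n /
            (rademacherGame n hn).oneWayClassicalValue k) ∧
    (∀ (X : Type u) (Y : Type v) [Fintype X] [Fintype Y] (G : XORGame X Y) (n : ℕ), 0 < n →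
      0 < G.classicalValue ∧
      G.oneWayQuantumValue n ≤ √(n : ℝ) * G.quantumValue ∧
      √(n : ℝ) * G.quantumValue ≤ realGrothendieckConstant * √(n : ℝ) * G.classicalValue ∧
      ∀ k : ℕ, 1 ≤ k →
        0 < G.oneWayClassicalValue k ∧
        G.oneWayQuantumValue n / G.oneWayClassicalValue k ≤
          G.oneWayQuantumValue n / G.classicalValue ∧
        G.oneWayQuantumValue n / G.classicalValue ≤ realGrothendieckConstant * √(n : ℝ)) := by
  -- The constant is the quotient of the quantum lower bound `1/8` by the classical `2 √2 e²`; being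
  -- below `1/8`, it serves both claims.
  refine ⟨⟨1 / 8 / (2 * √2 * Real.exp 2), by positivity, fun n hn => ⟨?_, ?_,
    rademacherGame_coeff hn, ?_, fun k hk => ⟨oneWayClassicalValue_rademacherGame_le hn hk, ?_⟩⟩⟩,
    fun X Y _ _ G n hn => ?_⟩
  · simp [two_mul, pow_add]
  · simp [sq]
  · refine le_trans ?_ (le_oneWayQuantumValue_rademacherGame hn)
    refine div_le_div_of_nonneg_right (div_le_self (by norm_num) ?_) (Real.sqrt_nonneg _)
    have h1 : 1 ≤ √2 := Real.one_le_sqrt.2 (by norm_num)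
    have h2 : 1 ≤ Real.exp 2 := Real.one_le_exp (by norm_num)
    nlinarith
  · have hn' : (0 : ℝ) < n := by exact_mod_cast hn
    have hk0 : (0 : ℝ) < k := (Real.exp_pos 2).trans_le hk
    have hlog : 0 < Real.log k :=
      lt_of_lt_of_le two_pos ((Real.le_log_iff_exp_le hk0).2 hk)
    have hpos : 0 < (rademacherGame n hn).oneWayClassicalValue k :=
      (classicalValue_pos _).trans_le
        (classicalValue_le_oneWayClassicalValue (by exact_mod_cast hk0))
    rw [le_div_iff₀ hpos]
    refine le_trans ?_ (le_oneWayQuantumValue_rademacherGame hn)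
    have hs : 0 < √(n : ℝ) := Real.sqrt_pos.2 hn'
    have hs2 := Real.sq_sqrt hn'.le
    calc 1 / 8 / (2 * √2 * Real.exp 2) * (√(n : ℝ) / Real.log k) *
          (rademacherGame n hn).oneWayClassicalValue k
        ≤ 1 / 8 / (2 * √2 * Real.exp 2) * (√(n : ℝ) / Real.log k) *
          (2 * √2 * Real.exp 2 / (n : ℝ) * Real.log k) :=
          mul_le_mul_of_nonneg_left (oneWayClassicalValue_rademacherGame_le hn hk) (by positivity)
      _ = 1 / 8 / √(n : ℝ) := by
          field_simp
          rw [hs2]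
  · have hω := classicalValue_pos G
    have h1 := oneWayQuantumValue_le (G := G) hn
    have h2 : √(n : ℝ) * G.quantumValue ≤
        realGrothendieckConstant * √(n : ℝ) * G.classicalValue := by
      refine (mul_le_mul_of_nonneg_left quantumValue_le (Real.sqrt_nonneg _)).trans (le_of_eq ?_)
      ring
    refine ⟨hω, h1, h2, fun k hk => ?_⟩
    have hle := classicalValue_le_oneWayClassicalValue (G := G) hk
    refine ⟨hω.trans_le hle, div_le_div_of_nonneg_left (bellValue_nonneg _ _) hω hle, ?_⟩
    rw [div_le_iff₀ hω]
    exact h1.trans h2
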